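/- **Conventions.** In a symmetric monoidal category $\mathcal{C}$ with unit $I$, write $c_1\otimes\cdots\otimes c_k$ for the left-bracketed product $((c_1\otimes c_2)\otimes\cdots)\otimes c_k$ (it is $I$ for $k=0$ and $c_1$ for $k=1$), and $c^{\otimes m}$ for the product of $m$ copies of $c$. Let $\sigma\colon c^{\otimes m}\otimes d^{\otimes m}\to(c\otimes d)^{\otimes m}$ and $\sigma\colon I\to I^{\otimes m}$ be the canonical symmetry isomorphisms. A *prop* is a symmetric strict monoidal category $\mathbb{P}$ whose monoid of objects is $(\mathbb{N},0,+)$. A *supply* of $\mathbb{P}$ in $\mathcal{C}$ is a family of strong symmetric monoidal functors $s_c\colon\mathbb{P}\to\mathcal{C}$, one for each object $c$ of $\mathcal{C}$, such that (i) $s_c(m)=c^{\otimes m}$ for all $m$; (ii) the structure isomorphism $c^{\otimes m}\otimes c^{\otimes n}\to c^{\otimes(m+n)}$ of $s_c$ is the coherence isomorphism made of associators and unitors, for all $m,n$; and (iii) for all objects $c,d$ and all $\mu\colon m\to n$ in $\mathbb{P}$, $s_{c\otimes d}(\mu)\circ\sigma=\sigma\circ(s_c(\mu)\otimes s_d(\mu))$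 and $s_I(\mu)\circ\sigma=\sigma$. The *Mac Lane strictification* $\mathcal{C}^{\mathrm{str}}$ has as objects the finite lists $[c_1,\dots,c_k]$ of objects of $\mathcal{C}$, and as morphisms $[c_1,\dots,c_k]\to[d_1,\dots,d_l]$ the morphisms $c_1\otimes\cdots\otimes c_k\to d_1\otimes\cdots\otimes d_l$ of $\mathcal{C}$. It is a symmetric strict monoidal category under concatenation of lists, written $\cdot$, with the tensor product of morphisms and the braiding taken from $\mathcal{C}$ via the coherence isomorphisms. There is a strong symmetric monoidal, fully faithful functor $\bigotimes\colon\mathcal{C}^{\mathrm{str}}\to\mathcal{C}$, $[c_1,\dots,c_k]\mapsto c_1\otimes\cdots\otimes c_k$. **Proposition.** Let $\mathbb{P}$ be a prop, $\mathcal{C}$ a symmetric monoidal category and $s$ a supply of $\mathbb{P}$ in $\mathcal{C}$. Then $s$ induces a supply $t$ of $\mathbb{P}$ in $\mathcal{C}^{\mathrm{str}}$. Precisely, there is a supply $t$ of $\mathbb{P}$ in $\mathcal{C}^{\mathrm{str}}$ such that every functor $t_L$ is strict monoidal; for each object $c$ of $\mathcal{C}$ the functor $s_c$ factors as $\mathbb{P}\xrightarrow{\,t_{[c]}\,}\mathcal{C}^{\mathrm{str}}\xrightarrow{\,\bigotimes\,}\mathcal{C}$,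 as a strong monoidal functor; and for each list $L=[c_1,\dots,c_k]$ and each $\mu\colon m\to n$ in $\mathbb{P}$, $$t_L(\mu)=\sigma\circ\bigl(t_{[c_1]}(\mu)\cdot\ldots\cdot t_{[c_k]}(\mu)\bigr)\circ\sigma^{-1},$$ where $\sigma\colon[c_1]^{\otimes m}\cdot\ldots\cdot[c_k]^{\otimes m}\to L^{\otimes m}$ (and likewise for $n$) is the symmetry isomorphism of $\mathcal{C}^{\mathrm{str}}$. -/

import Mathlib

open CategoryTheory MonoidalCategory

noncomputable section

namespace Supplies

universe v u v₁ u₁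

/-! ### Strict monoidal categories and props -/

/-- A monoidal category is strict if tensoring is associative and unital on the nose and the
associators and unitors are identities. -/
class StrictMonoidal (C : Type u) [Category.{v} C] [MonoidalCategory C] : Prop where
  assoc : ∀ X Y Z : C, (X ⊗ Y) ⊗ Z = X ⊗ (Y ⊗ Z)
  unit_tensor : ∀ X : C, 𝟙_ C ⊗ X = X
  tensor_unit : ∀ X : C, X ⊗ 𝟙_ C = X
  associator_eq : ∀ X Y Z : C, (α_ X Y Z).hom = eqToHom (assoc X Y Z)
  leftUnitor_eq : ∀ X : C, (λ_ X).hom = eqToHom (unit_tensor X)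
  rightUnitor_eq : ∀ X : C, (ρ_ X).hom = eqToHom (tensor_unit X)

/-- A prop: a symmetric strict monoidal category whose monoid of objects is `(ℕ, 0, +)`.
`ob m` is the object named by the natural number `m`. -/
class PropCat (P : Type u₁) [Category.{v₁} P] [MonoidalCategory P] [SymmetricCategory P] extends
    StrictMonoidal P where
  ob : ℕ → P
  ob_bijective : Function.Bijective ob
  ob_zero : ob 0 = 𝟙_ P
  ob_add : ∀ m n : ℕ, ob (m + n) = ob m ⊗ ob n

/-- A strong monoidal functor is strict if its structure isomorphisms are identities. -/
def IsStrictFunctor {C : Type u} [Category.{v} C] [MonoidalCategory C]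
    {D : Type u₁} [Category.{v₁} D] [MonoidalCategory D] (F : C ⥤ D) [F.Monoidal] : Prop :=
  (∃ h : 𝟙_ D = F.obj (𝟙_ C), Functor.LaxMonoidal.ε F = eqToHom h) ∧
    ∀ X Y : C, ∃ h : F.obj X ⊗ F.obj Y = F.obj (X ⊗ Y),
      Functor.LaxMonoidal.μ F X Y = eqToHom h

/-- Two functors are equal as strong monoidal functors: equal on objects and morphisms, with the same
structure isomorphisms. -/
def SameMonoidalFunctor {C : Type u} [Category.{v} C] [MonoidalCategory C]
    {D : Type u₁} [Category.{v₁} D] [MonoidalCategory D] (F G : C ⥤ D) [F.Monoidal] [G.Monoidal] :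
    Prop :=
  F = G ∧ HEq (Functor.LaxMonoidal.ε F) (Functor.LaxMonoidal.ε G) ∧
    ∀ X Y : C, HEq (Functor.LaxMonoidal.μ F X Y) (Functor.LaxMonoidal.μ G X Y)

/-! ### Tensor powers and their canonical isomorphisms -/

section Powers

variable {C : Type u} [Category.{v} C] [MonoidalCategory C]

/-- The tensor power `((c ⊗ c) ⊗ ⋯) ⊗ c`, with `tpow c 0 = 𝟙_ C` and `tpow c 1 = c`. -/
@[reducible] def tpow (c : C) : ℕ → C
  | 0 => 𝟙_ C
  | 1 => c
  | n + 2 => tpow c (n + 1) ⊗ c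

/-- The canonical isomorphism `c^(n+1) ≅ c^n ⊗ c`; it is a unitor for `n = 0` and the identity
otherwise. -/
def tpowSucc (c : C) : ∀ n : ℕ, tpow c (n + 1) ≅ tpow c n ⊗ c
  | 0 => (λ_ c).symm
  | _ + 1 => Iso.refl _

/-- The coherence isomorphism `c^m ⊗ c^n ≅ c^(m+n)`, composed of associators and unitors. -/
def tpowAdd (c : C) (m : ℕ) : ∀ n : ℕ, tpow c m ⊗ tpow c n ≅ tpow c (m + n)
  | 0 => ρ_ _
  | n + 1 =>
      whiskerLeftIso (tpow c m) (tpowSucc c n) ≪≫ (α_ (tpow c m) (tpow c n) c).symm ≪≫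
        whiskerRightIso (tpowAdd c m n) c ≪≫ (tpowSucc c (m + n)).symm

/-- The symmetry isomorphism `I ≅ I^n`. -/
def symmUnit (C : Type u) [Category.{v} C] [MonoidalCategory C] :
    ∀ n : ℕ, 𝟙_ C ≅ tpow (𝟙_ C) n
  | 0 => Iso.refl _
  | n + 1 =>
      (λ_ (𝟙_ C)).symm ≪≫ whiskerRightIso (symmUnit C n) (𝟙_ C) ≪≫ (tpowSucc (𝟙_ C) n).symm

/-- The middle-four interchange `(a ⊗ b) ⊗ (c ⊗ d) ≅ (a ⊗ c) ⊗ (b ⊗ d)`, as an isomorphism. -/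
def interchange [SymmetricCategory C] (a b c d : C) :
    (a ⊗ b) ⊗ (c ⊗ d) ≅ (a ⊗ c) ⊗ (b ⊗ d) where
  hom := tensorμ a b c d
  inv := tensorδ a b c d
  hom_inv_id := tensorμ_tensorδ a b c d
  inv_hom_id := tensorδ_tensorμ a b c d

/-- The symmetry isomorphism `c^n ⊗ d^n ≅ (c ⊗ d)^n`, interleaving the factors. -/
def symmTensor [SymmetricCategory C] (c d : C) :
    ∀ n : ℕ, tpow c n ⊗ tpow d n ≅ tpow (c ⊗ d) n
  | 0 => λ_ (𝟙_ C)
  | n + 1 =>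
      (tpowSucc c n ⊗ᵢ tpowSucc d n) ≪≫ interchange (tpow c n) c (tpow d n) d ≪≫
        whiskerRightIso (symmTensor c d n) (c ⊗ d) ≪≫ (tpowSucc (c ⊗ d) n).symm

end Powers

/-! ### Supply -/

open PropCat in
/-- A supply of the prop `P` in the symmetric monoidal category `C`: a strong symmetric monoidal
functor `s_c : P ⥤ C` for each object `c`, with
(i) `s_c(m) = c^m`,
(ii) structure isomorphisms `c^m ⊗ c^n ⟶ c^(m+n)` the coherence isomorphisms, and
(iii) compatibility with the tensor products and the unit of `C`.
The morphisms `eqToHom _` only express the identifications of objects in (i) and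
`ob (m + n) = ob m ⊗ ob n`. -/
structure Supply (P : Type u₁) [Category.{v₁} P] [MonoidalCategory P] [SymmetricCategory P]
    [PropCat P] (C : Type u) [Category.{v} C] [MonoidalCategory C] [SymmetricCategory C] where
  functor : C → P ⥤ C
  [braided : ∀ c : C, (functor c).Braided]
  obj_eq : ∀ (c : C) (m : ℕ), (functor c).obj (ob m) = tpow c m
  mu_eq : ∀ (c : C) (m n : ℕ),
    (eqToHom (obj_eq c m).symm ⊗ₘ eqToHom (obj_eq c n).symm) ≫
        Functor.LaxMonoidal.μ (functor c) (ob m) (ob n) ≫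
        eqToHom ((congrArg (functor c).obj (ob_add m n).symm).trans (obj_eq c (m + n))) =
      (tpowAdd c m n).hom
  tensor_comm : ∀ (c d : C) (m n : ℕ) (f : (ob m : P) ⟶ ob n),
    ((eqToHom (obj_eq c m).symm ≫ (functor c).map f ≫ eqToHom (obj_eq c n)) ⊗ₘ
          (eqToHom (obj_eq d m).symm ≫ (functor d).map f ≫ eqToHom (obj_eq d n))) ≫
        (symmTensor c d n).hom =
      (symmTensor c d m).hom ≫
        (eqToHom (obj_eq (c ⊗ d) m).symm ≫ (functor (c ⊗ d)).map f ≫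
          eqToHom (obj_eq (c ⊗ d) n))
  unit_comm : ∀ (m n : ℕ) (f : (ob m : P) ⟶ ob n),
    (symmUnit C n).hom =
      (symmUnit C m).hom ≫
        (eqToHom (obj_eq (𝟙_ C) m).symm ≫ (functor (𝟙_ C)).map f ≫ eqToHom (obj_eq (𝟙_ C) n))

attribute [instance] Supply.braided

/-- The morphism `s_c(f) : c^m ⟶ c^n` for `f : m ⟶ n` in the prop. -/
def Supply.app {P : Type u₁} [Category.{v₁} P] [MonoidalCategory P] [SymmetricCategory P]
    [PropCat P] {C : Type u} [Category.{v} C] [MonoidalCategory C] [SymmetricCategory C]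
    (s : Supply P C) (c : C) {m n : ℕ} (f : (PropCat.ob m : P) ⟶ PropCat.ob n) :
    tpow c m ⟶ tpow c n :=
  eqToHom (s.obj_eq c m).symm ≫ (s.functor c).map f ≫ eqToHom (s.obj_eq c n)

/-! ### The Mac Lane strictification -/

section Lists

variable {C : Type u} [Category.{v} C] [MonoidalCategory C]

/-- `((X ⊗ c₁) ⊗ ⋯) ⊗ cₖ` for the list `[c₁, …, cₖ]`. -/
@[reducible] def tensorFrom (X : C) : List C → C
  | [] => X
  | c :: l => tensorFrom (X ⊗ c) l

/-- The left-bracketed tensor product `((c₁ ⊗ c₂) ⊗ ⋯) ⊗ cₖ` of a list, with value `𝟙_ C` on the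
empty list and `c` on `[c]`. -/
@[reducible] def bigTensor : List C → C
  | [] => 𝟙_ C
  | c :: l => tensorFrom c l

/-- `tensorFrom X l` is functorial in `X`. -/
def tensorFromIso {X Y : C} (e : X ≅ Y) : ∀ l : List C, tensorFrom X l ≅ tensorFrom Y l
  | [] => e
  | c :: l => tensorFromIso (whiskerRightIso e c) l

/-- The canonical isomorphism `X ⊗ (((Y ⊗ c₁) ⊗ ⋯) ⊗ cₖ) ≅ (((X ⊗ Y) ⊗ c₁) ⊗ ⋯) ⊗ cₖ`. -/
def tensorFromAssoc (X Y : C) : ∀ l : List C, X ⊗ tensorFrom Y l ≅ tensorFrom (X ⊗ Y) l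
  | [] => Iso.refl _
  | c :: l => tensorFromAssoc X (Y ⊗ c) l ≪≫ tensorFromIso (α_ X Y c).symm l

/-- The canonical isomorphism `X ⊗ ⨂ M ≅ ((X ⊗ c₁) ⊗ ⋯) ⊗ cₖ` for `M = [c₁, …, cₖ]`. -/
def tensorBig (X : C) : ∀ M : List C, X ⊗ bigTensor M ≅ tensorFrom X M
  | [] => ρ_ X
  | c :: l => tensorFromAssoc X c l

/-- The canonical isomorphism `(((X ⊗ c₁) ⊗ ⋯) ⊗ cₖ) ⊗ ⨂ M ≅ tensorFrom X (l ++ M)` for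
`l = [c₁, …, cₖ]`. -/
def tensorFromAppend (M : List C) : ∀ (X : C) (l : List C),
    tensorFrom X l ⊗ bigTensor M ≅ tensorFrom X (l ++ M)
  | X, [] => tensorBig X M
  | X, c :: l => tensorFromAppend M (X ⊗ c) l

/-- The canonical isomorphism `⨂ L ⊗ ⨂ M ≅ ⨂ (L ++ M)`, composed of associators and unitors. -/
def bigTensorAppend : ∀ L M : List C, bigTensor L ⊗ bigTensor M ≅ bigTensor (L ++ M)
  | [], M => λ_ (bigTensor M)
  | c :: l, M => tensorFromAppend M c l

theorem tensorFromIso_trans {X Y Z : C} (e : X ≅ Y) (f : Y ≅ Z) (l : List C) :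
    tensorFromIso (e ≪≫ f) l = tensorFromIso e l ≪≫ tensorFromIso f l := by
  induction l generalizing X Y Z with
  | nil => rfl
  | cons c l ih =>
    change tensorFromIso (whiskerRightIso (e ≪≫ f) c) l =
      tensorFromIso (whiskerRightIso e c) l ≪≫ tensorFromIso (whiskerRightIso f c) l
    rw [← ih, whiskerRightIso_trans]

theorem tensorFromIso_refl (X : C) (l : List C) :
    tensorFromIso (Iso.refl X) l = Iso.refl _ := by
  induction l generalizing X with
  | nil => rfl
  | cons c l ih =>
    simp only [tensorFromIso]
    rw [← ih]
    congr 1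
    ext
    simp

theorem tensorFromAssoc_natural_right (X : C) {Y Y' : C} (e : Y ≅ Y') (l : List C) :
    whiskerLeftIso X (tensorFromIso e l) ≪≫ tensorFromAssoc X Y' l =
      tensorFromAssoc X Y l ≪≫ tensorFromIso (whiskerLeftIso X e) l := by
  induction l generalizing Y Y' with
  | nil => ext; simp [tensorFromIso, tensorFromAssoc]
  | cons c l ih =>
    simp only [tensorFromIso, tensorFromAssoc]
    rw [← Iso.trans_assoc, ih, Iso.trans_assoc, Iso.trans_assoc, ← tensorFromIso_trans,
      ← tensorFromIso_trans]
    congr 2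
    ext; simp

theorem tensorFromAssoc_assoc (X Y Z : C) (l : List C) :
    tensorFromAssoc (X ⊗ Y) Z l ≪≫ tensorFromIso (α_ X Y Z) l =
      α_ X Y (tensorFrom Z l) ≪≫ whiskerLeftIso X (tensorFromAssoc Y Z l) ≪≫
        tensorFromAssoc X (Y ⊗ Z) l := by
  induction l generalizing Z with
  | nil => ext; simp [tensorFromIso, tensorFromAssoc]
  | cons c l ih =>
    simp only [tensorFromIso, tensorFromAssoc, whiskerLeftIso_trans, Iso.trans_assoc]
    rw [← Iso.trans_assoc (whiskerLeftIso X (tensorFromIso (α_ Y Z c).symm l)),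
      tensorFromAssoc_natural_right, Iso.trans_assoc, ← tensorFromIso_trans]
    have h : tensorFromAssoc (X ⊗ Y) (Z ⊗ c) l =
        (α_ X Y (tensorFrom (Z ⊗ c) l) ≪≫ whiskerLeftIso X (tensorFromAssoc Y (Z ⊗ c) l) ≪≫
          tensorFromAssoc X (Y ⊗ Z ⊗ c) l) ≪≫ tensorFromIso (α_ X Y (Z ⊗ c)).symm l := by
      rw [← ih, Iso.trans_assoc, ← tensorFromIso_trans, Iso.self_symm_id]
      ext
      simp [tensorFromIso_refl]
    rw [h]
    simp only [Iso.trans_assoc, ← tensorFromIso_trans]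
    congr 4
    ext
    simp

theorem tensorBig_assoc (X Y : C) (N : List C) :
    tensorBig (X ⊗ Y) N =
      α_ X Y (bigTensor N) ≪≫ whiskerLeftIso X (tensorBig Y N) ≪≫ tensorFromAssoc X Y N := by
  cases N with
  | nil => ext; simp [tensorBig, tensorFromAssoc]
  | cons e n =>
    simp only [tensorBig, tensorFromAssoc]
    rw [← Iso.trans_assoc (whiskerLeftIso _ _), ← Iso.trans_assoc, ← tensorFromAssoc_assoc,
      Iso.trans_assoc, ← tensorFromIso_trans, Iso.self_symm_id, tensorFromIso_refl]
    ext
    simp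

theorem tensorFromAssoc_natural_left {X X' : C} (e : X ≅ X') (Y : C) (l : List C) :
    whiskerRightIso e (tensorFrom Y l) ≪≫ tensorFromAssoc X' Y l =
      tensorFromAssoc X Y l ≪≫ tensorFromIso (whiskerRightIso e Y) l := by
  induction l generalizing Y with
  | nil => ext; simp [tensorFromIso, tensorFromAssoc]
  | cons c l ih =>
    simp only [tensorFromIso, tensorFromAssoc]
    rw [← Iso.trans_assoc, ih, Iso.trans_assoc, Iso.trans_assoc, ← tensorFromIso_trans,
      ← tensorFromIso_trans]
    congr 2
    ext; simp

theorem tensorFromAppend_natural {X X' : C} (e : X ≅ X') (l N : List C) :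
    whiskerRightIso (tensorFromIso e l) (bigTensor N) ≪≫ tensorFromAppend N X' l =
      tensorFromAppend N X l ≪≫ tensorFromIso e (l ++ N) := by
  induction l generalizing X X' with
  | nil =>
    cases N with
    | nil => ext; simp [tensorFromIso, tensorFromAppend, tensorBig]
    | cons c n => exact tensorFromAssoc_natural_left e c n
  | cons c l ih => exact ih (whiskerRightIso e c)

theorem tensorFromAppend_assoc (X d : C) (m N : List C) :
    whiskerRightIso (tensorFromAssoc X d m) (bigTensor N) ≪≫ tensorFromAppend N (X ⊗ d) m =
      α_ X (tensorFrom d m) (bigTensor N) ≪≫ whiskerLeftIso X (tensorFromAppend N d m) ≪≫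
        tensorFromAssoc X d (m ++ N) := by
  induction m generalizing d with
  | nil =>
    simp only [tensorFromAssoc, tensorFromAppend]
    refine Eq.trans ?_ (tensorBig_assoc X d N)
    ext
    simp
  | cons c m ih =>
    have h := tensorFromAppend_natural (α_ X d c).symm m N
    simp only [tensorFromAssoc, tensorFromAppend, whiskerRightIso_trans, Iso.trans_assoc,
      List.cons_append]
    rw [h, ← Iso.trans_assoc, ih]
    simp only [Iso.trans_assoc]

theorem tensorFromAppend_append (X : C) (l M N : List C) :
    whiskerRightIso (tensorFromAppend M X l) (bigTensor N) ≪≫ tensorFromAppend N X (l ++ M) ≪≫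
        eqToIso (congrArg (tensorFrom X) (List.append_assoc l M N)) =
      α_ (tensorFrom X l) (bigTensor M) (bigTensor N) ≪≫
        whiskerLeftIso (tensorFrom X l) (bigTensorAppend M N) ≪≫ tensorFromAppend (M ++ N) X l := by
  induction l generalizing X with
  | nil =>
    cases M with
    | nil => ext; simp [tensorFromAppend, bigTensorAppend, tensorBig]
    | cons d m =>
      refine Eq.trans ?_ (tensorFromAppend_assoc X d m N)
      ext
      simp [tensorFromAppend, tensorBig]
  | cons c l ih => exact ih (X ⊗ c)

theorem bigTensorAppend_assoc (L M N : List C) :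
    whiskerRightIso (bigTensorAppend L M) (bigTensor N) ≪≫ bigTensorAppend (L ++ M) N ≪≫
        eqToIso (congrArg bigTensor (List.append_assoc L M N)) =
      α_ (bigTensor L) (bigTensor M) (bigTensor N) ≪≫
        whiskerLeftIso (bigTensor L) (bigTensorAppend M N) ≪≫ bigTensorAppend L (M ++ N) := by
  cases L with
  | nil => ext; simp [bigTensorAppend]
  | cons c l => exact tensorFromAppend_append c l M N

theorem tensorFromAppend_nil (X : C) (l : List C) :
    tensorFromAppend [] X l ≪≫ eqToIso (congrArg (tensorFrom X) (List.append_nil l)) =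
      ρ_ (tensorFrom X l) := by
  induction l generalizing X with
  | nil => ext; simp [tensorFromAppend, tensorBig]
  | cons c l ih => exact ih (X ⊗ c)

theorem bigTensorAppend_nil (L : List C) :
    bigTensorAppend L [] ≪≫ eqToIso (congrArg bigTensor (List.append_nil L)) =
      ρ_ (bigTensor L) := by
  cases L with
  | nil => ext; simp [bigTensorAppend, unitors_equal]
  | cons c l => exact tensorFromAppend_nil c l

end Lists

section Strictification

/-- The Mac Lane strictification of `C`: objects are lists of objects of `C`, and a morphism
`L ⟶ M` is a morphism `⨂ L ⟶ ⨂ M` in `C`. -/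
abbrev Strictification (C : Type u) [Category.{v} C] [MonoidalCategory C] : Type u :=
  InducedCategory C (bigTensor : List C → C)

variable (C : Type u) [Category.{v} C] [MonoidalCategory C]

/-- The functor `⨂ : Strictification C ⥤ C`, fully faithful by construction. -/
abbrev tensorFunctor : Strictification C ⥤ C :=
  inducedFunctor (bigTensor : List C → C)

variable {C}

/-- A list, seen as an object of the strictification. -/
abbrev ofList (L : List C) : Strictification C := L

/-- The monoidal product is concatenation of lists, the unit is the empty list, and the associators
and unitors are identities. Morphisms are tensored in `C` through `⨂ L ⊗ ⨂ M ≅ ⨂ (L ++ M)`. -/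
instance : MonoidalCategoryStruct (Strictification C) where
  tensorObj L M := ofList (@HAppend.hAppend (List C) (List C) (List C) _ L M)
  tensorUnit := ofList []
  whiskerLeft L _ _ f := InducedCategory.homMk
    ((bigTensorAppend L _).inv ≫ bigTensor L ◁ f.hom ≫ (bigTensorAppend L _).hom)
  whiskerRight f M := InducedCategory.homMk
    ((bigTensorAppend _ M).inv ≫ f.hom ▷ bigTensor M ≫ (bigTensorAppend _ M).hom)
  tensorHom f g := InducedCategory.homMk
    ((bigTensorAppend _ _).inv ≫ (f.hom ⊗ₘ g.hom) ≫ (bigTensorAppend _ _).hom)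
  associator L M N := eqToIso (List.append_assoc L M N)
  leftUnitor L := eqToIso (List.nil_append L)
  rightUnitor L := eqToIso (List.append_nil L)

/-- The comparison data which make `⨂` strong monoidal. -/
def inducingData : Monoidal.InducingFunctorData (tensorFunctor C) where
  μIso L M := bigTensorAppend L M
  εIso := Iso.refl _
  associator_eq L M N := by
    have h := congrArg Iso.hom (bigTensorAppend_assoc (C := C) L M N)
    have e : (tensorFunctor C).map (α_ L M N).hom =
        eqToHom (congrArg bigTensor (List.append_assoc L M N)) :=
      eqToHom_map (tensorFunctor C) (List.append_assoc L M N)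
    rw [e]
    simp only [Iso.trans_hom, whiskerRightIso_hom, whiskerLeftIso_hom, eqToIso.hom] at h
    simp only [Iso.trans_hom, Iso.symm_hom, tensorIso_hom, Iso.refl_hom, tensorHom_id,
      id_tensorHom, Category.assoc]
    refine (Iso.eq_inv_comp
      (bigTensorAppend (@HAppend.hAppend (List C) (List C) (List C) _ L M) N)).2 ?_
    refine (Iso.eq_inv_comp (whiskerRightIso (bigTensorAppend L M) (bigTensor N))).2 ?_
    exact h
  leftUnitor_eq L := by
    have e : (tensorFunctor C).map (λ_ L).hom = 𝟙 (bigTensor L) :=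
      eqToHom_map (tensorFunctor C) (List.nil_append L)
    rw [e]
    change _ = ((λ_ (bigTensor L)).inv ≫ (𝟙 (𝟙_ C) ⊗ₘ 𝟙 (bigTensor L))) ≫ (λ_ (bigTensor L)).hom
    simp
  rightUnitor_eq L := by
    have h := congrArg Iso.hom (bigTensorAppend_nil (C := C) L)
    have e : (tensorFunctor C).map (ρ_ L).hom =
        eqToHom (congrArg bigTensor (List.append_nil L)) :=
      eqToHom_map (tensorFunctor C) (List.append_nil L)
    rw [e]
    change _ = ((bigTensorAppend L []).inv ≫ (𝟙 (bigTensor L) ⊗ₘ 𝟙 (𝟙_ C))) ≫ (ρ_ (bigTensor L)).hom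
    rw [id_tensorHom_id, Category.assoc, Category.id_comp]
    exact (Iso.eq_inv_comp (bigTensorAppend L [])).2 h

instance : MonoidalCategory (Strictification C) :=
  Monoidal.induced (tensorFunctor C) inducingData

instance : StrictMonoidal (Strictification C) where
  assoc L M N := List.append_assoc L M N
  unit_tensor L := List.nil_append L
  tensor_unit L := List.append_nil L
  associator_eq _ _ _ := rfl
  leftUnitor_eq _ := rfl
  rightUnitor_eq _ := rfl

/-- `⨂ : Strictification C ⥤ C` is strong monoidal. -/
instance : (tensorFunctor C).Monoidal :=
  (Monoidal.fromInducedCoreMonoidal (tensorFunctor C) inducingData).toMonoidal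

variable [SymmetricCategory C]

/-- The braiding of lists: the braiding of `C` conjugated by `⨂ L ⊗ ⨂ M ≅ ⨂ (L ++ M)`. -/
def strictBraiding (L M : Strictification C) : L ⊗ M ≅ M ⊗ L :=
  InducedCategory.isoMk
    ((bigTensorAppend L M).symm ≪≫ β_ (bigTensor L) (bigTensor M) ≪≫ bigTensorAppend M L)

instance : BraidedCategory (Strictification C) :=
  BraidedCategory.ofFaithful (tensorFunctor C) strictBraiding (fun L M =>
    Iso.hom_inv_id_assoc (bigTensorAppend L M) _)

/-- `⨂ : Strictification C ⥤ C` is symmetric monoidal. -/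
instance : (tensorFunctor C).Braided where
  braided L M := Iso.hom_inv_id_assoc (bigTensorAppend L M) _

instance : SymmetricCategory (Strictification C) :=
  SymmetricCategory.ofFaithful (tensorFunctor C)

/-! ### Pieces of the induced supply -/

/-- The object `[c₁,…,c₁] · ⋯ · [cₖ,…,cₖ]` of the strictification, each `cᵢ` repeated `m` times. -/
def blocks (m : ℕ) : List C → Strictification C
  | [] => 𝟙_ (Strictification C)
  | c :: l => tpow (ofList [c]) m ⊗ blocks m l

/-- The morphism `g c₁ · ⋯ · g cₖ` between such objects. -/
def blocksMap {m n : ℕ} (g : ∀ c : C, tpow (ofList [c]) m ⟶ tpow (ofList [c]) n) :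
    ∀ L : List C, blocks m L ⟶ blocks n L
  | [] => 𝟙 _
  | c :: l => g c ⊗ₘ blocksMap g l

/-- The symmetry isomorphism
`[c₁,…,c₁] · ⋯ · [cₖ,…,cₖ] ≅ [c₁,…,cₖ] · ⋯ · [c₁,…,cₖ]` (with `m` factors on the right). -/
def blocksSymm (m : ℕ) : ∀ L : List C, blocks m L ≅ tpow (ofList L) m
  | [] => symmUnit (Strictification C) m
  | c :: l =>
      whiskerLeftIso (tpow (ofList [c]) m) (blocksSymm m l) ≪≫
        symmTensor (ofList [c]) (ofList l) m

end Strictification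

end Supplies

end

/-! Since `⨂` is fully faithful, `t_L(μ)` can be defined as the unique morphism `L^m ⟶ L^n` that `⨂`
sends to `s_{⨂L}(μ)`, conjugated by the comparison `(⨂L)^m ≅ ⨂(L^m)`. Every axiom for `t` can then
be checked in `C` after applying `⨂`. Functoriality and compatibility with tensor products and
braidings are inherited from `s`, because the comparison respects `c^m ⊗ c^n ≅ c^(m+n)`
(`tpowComparison_tpowAdd`). In a strict category these isomorphisms are identities, so each `t_L` is
a strict functor.

The substance is axiom (iii). The comparison carries the interleaving `σ` of the strictification to
that of `C` only up to the `m`-th tensor power of `⨂L ⊗ ⨂M ≅ ⨂(L ++ M)`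
(`tpowComparison_symmTensor`). One therefore needs tensor powers of this isomorphism to commute with
all supplied morphisms, that is, the isomorphism must be homomorphic for `s`. Homomorphic morphisms
are closed under composition, inverses and tensor products. Associators and unitors are homomorphic
by axiom (iii) for `s` together with the coherence of `σ` (`symmTensor_associator` and its unit
versions). The isomorphism in question is built from these.

The formula for `t_L` holds for any supply in the strictification, by iterating axiom (iii). On
singletons the comparison is an identity (`tpowComparison_singleton`), which gives the factorization
of `s_c`. -/

open CategoryTheory MonoidalCategory

noncomputable section

namespace Supplies

universe v u v₁ u₁ v₂ u₂

/-! ### Tensor powers of morphisms, and coherence of the interleaving symmetries. -/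

section PowerMaps

variable {C : Type u} [Category.{v} C] [MonoidalCategory C]

/-- The tensor power `f ⊗ ⋯ ⊗ f : c^n ⟶ d^n` of a morphism. -/
def tpowMap {c d : C} (f : c ⟶ d) : ∀ n : ℕ, tpow c n ⟶ tpow d n
  | 0 => 𝟙 _
  | n + 1 => (tpowSucc c n).hom ≫ (tpowMap f n ⊗ₘ f) ≫ (tpowSucc d n).inv

theorem tpowMap_succ {c d : C} (f : c ⟶ d) (n : ℕ) :
    tpowMap f (n + 1) = (tpowSucc c n).hom ≫ (tpowMap f n ⊗ₘ f) ≫ (tpowSucc d n).inv :=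
  rfl

theorem tpowMap_id (c : C) (n : ℕ) : tpowMap (𝟙 c) n = 𝟙 _ := by
  induction n with
  | zero => rfl
  | succ n ih => simp [tpowMap_succ, ih]

theorem tpowMap_comp {c d e : C} (f : c ⟶ d) (g : d ⟶ e) (n : ℕ) :
    tpowMap (f ≫ g) n = tpowMap f n ≫ tpowMap g n := by
  induction n with
  | zero => simp [tpowMap]
  | succ n ih => simp [tpowMap_succ, ih]

theorem tpowMap_hom_inv {c d : C} (e : c ≅ d) (n : ℕ) :
    tpowMap e.hom n ≫ tpowMap e.inv n = 𝟙 _ := by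
  rw [← tpowMap_comp, e.hom_inv_id, tpowMap_id]

theorem tpowMap_inv_hom {c d : C} (e : c ≅ d) (n : ℕ) :
    tpowMap e.inv n ≫ tpowMap e.hom n = 𝟙 _ :=
  tpowMap_hom_inv e.symm n

theorem symmUnit_succ_hom (n : ℕ) :
    (symmUnit C (n + 1)).hom =
      (λ_ (𝟙_ C)).inv ≫ (symmUnit C n).hom ▷ 𝟙_ C ≫ (tpowSucc (𝟙_ C) n).inv :=
  rfl

variable [SymmetricCategory C]

theorem symmTensor_succ_hom (c d : C) (n : ℕ) :
    (symmTensor c d (n + 1)).hom =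
      ((tpowSucc c n).hom ⊗ₘ (tpowSucc d n).hom) ≫ tensorμ (tpow c n) c (tpow d n) d ≫
        (symmTensor c d n).hom ▷ (c ⊗ d) ≫ (tpowSucc (c ⊗ d) n).inv :=
  rfl

theorem symmTensor_natural {c c' d d' : C} (f : c ⟶ c') (g : d ⟶ d') (n : ℕ) :
    (tpowMap f n ⊗ₘ tpowMap g n) ≫ (symmTensor c' d' n).hom =
      (symmTensor c d n).hom ≫ tpowMap (f ⊗ₘ g) n := by
  induction n with
  | zero => simp [tpowMap, symmTensor]
  | succ n ih =>
    simp only [tpowMap_succ, symmTensor_succ_hom, Category.assoc, Iso.inv_hom_id_assoc]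
    rw [tensorHom_comp_tensorHom_assoc]
    simp only [Category.assoc, Iso.inv_hom_id, Category.comp_id]
    rw [← tensorHom_comp_tensorHom_assoc, tensorμ_natural_assoc, ← tensorHom_id,
      tensorHom_comp_tensorHom_assoc, ih, ← tensorHom_id, tensorHom_comp_tensorHom_assoc,
      Category.id_comp, Category.comp_id]

/-- Interleaving three rows does not depend on bracketing. The inductive step splits off the last
column: the interchanges satisfy the associativity law `tensor_associativity`, and the first `n`
columns are the inductive hypothesis. This is what makes associators homomorphic. -/
theorem symmTensor_associator (a b c : C) (n : ℕ) :
    (symmTensor a b n).hom ▷ tpow c n ≫ (symmTensor (a ⊗ b) c n).hom ≫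
        tpowMap (α_ a b c).hom n =
      (α_ (tpow a n) (tpow b n) (tpow c n)).hom ≫ tpow a n ◁ (symmTensor b c n).hom ≫
        (symmTensor a (b ⊗ c) n).hom := by
  induction n with
  | zero =>
    change (λ_ (𝟙_ C)).hom ▷ 𝟙_ C ≫ (λ_ (𝟙_ C)).hom ≫ 𝟙 _ =
      (α_ (𝟙_ C) (𝟙_ C) (𝟙_ C)).hom ≫ 𝟙_ C ◁ (λ_ (𝟙_ C)).hom ≫ (λ_ (𝟙_ C)).hom
    monoidal
  | succ n ih =>
    have h₁ := tensorμ_natural (symmTensor a b n).hom (𝟙 (a ⊗ b)) (𝟙 (tpow c n)) (𝟙 c)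
    have h₂ := tensorμ_natural (𝟙 (tpow a n)) (𝟙 a) (symmTensor b c n).hom (𝟙 (b ⊗ c))
    simp only [tensorHom_id, id_tensorHom, id_whiskerRight] at h₁ h₂
    have e₁ : (symmTensor a b (n + 1)).hom ▷ tpow c (n + 1) ≫
        ((tpowSucc (a ⊗ b) n).hom ⊗ₘ (tpowSucc c n).hom) =
        (((tpowSucc a n).hom ⊗ₘ (tpowSucc b n).hom) ⊗ₘ (tpowSucc c n).hom) ≫
          tensorμ (tpow a n) a (tpow b n) b ▷ (tpow c n ⊗ c) ≫
            (symmTensor a b n).hom ▷ (a ⊗ b) ▷ (tpow c n ⊗ c) := by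
      simp only [symmTensor_succ_hom, ← tensorHom_id, tensorHom_comp_tensorHom,
        Category.assoc, Iso.inv_hom_id, Category.comp_id, Category.id_comp]
    have e₂ : tpow a (n + 1) ◁ (symmTensor b c (n + 1)).hom ≫
        ((tpowSucc a n).hom ⊗ₘ (tpowSucc (b ⊗ c) n).hom) =
        ((tpowSucc a n).hom ⊗ₘ ((tpowSucc b n).hom ⊗ₘ (tpowSucc c n).hom)) ≫
          (tpow a n ⊗ a) ◁ tensorμ (tpow b n) b (tpow c n) c ≫
            (tpow a n ⊗ a) ◁ (symmTensor b c n).hom ▷ (b ⊗ c) := by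
      simp only [symmTensor_succ_hom, ← tensorHom_id, ← id_tensorHom, tensorHom_comp_tensorHom,
        Category.assoc, Iso.inv_hom_id, Category.comp_id, Category.id_comp]
    rw [tpowMap_succ, symmTensor_succ_hom (a ⊗ b), symmTensor_succ_hom a (b ⊗ c)]
    simp only [Category.assoc, Iso.inv_hom_id_assoc]
    rw [reassoc_of% e₁, reassoc_of% e₂, reassoc_of% h₁, reassoc_of% h₂,
      ← associator_naturality_assoc, ← tensor_associativity_assoc]
    -- The inductive hypothesis, tensored with the associator of the last column.
    have e₃ : (symmTensor a b n).hom ▷ tpow c n ▷ ((a ⊗ b) ⊗ c) ≫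
        (symmTensor (a ⊗ b) c n).hom ▷ ((a ⊗ b) ⊗ c) ≫ (tpowMap (α_ a b c).hom n ⊗ₘ (α_ a b c).hom) =
        ((α_ (tpow a n) (tpow b n) (tpow c n)).hom ⊗ₘ (α_ a b c).hom) ≫
          (tpow a n ◁ (symmTensor b c n).hom) ▷ (a ⊗ b ⊗ c) ≫
            (symmTensor a (b ⊗ c) n).hom ▷ (a ⊗ b ⊗ c) := by
      simp only [← tensorHom_id, tensorHom_comp_tensorHom, Category.comp_id, Category.id_comp]
      simp only [tensorHom_id, ih]
    rw [reassoc_of% e₃]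

theorem symmTensor_leftUnitor (c : C) (n : ℕ) :
    (symmUnit C n).hom ▷ tpow c n ≫ (symmTensor (𝟙_ C) c n).hom ≫ tpowMap (λ_ c).hom n =
      (λ_ (tpow c n)).hom := by
  induction n with
  | zero => simp [tpowMap, symmTensor, symmUnit]
  | succ n ih =>
    have h := tensorμ_natural (symmUnit C n).hom (𝟙 (𝟙_ C)) (𝟙 (tpow c n)) (𝟙 c)
    simp only [tensorHom_id, id_whiskerRight] at h
    have e₁ : (symmUnit C (n + 1)).hom ▷ tpow c (n + 1) ≫
        ((tpowSucc (𝟙_ C) n).hom ⊗ₘ (tpowSucc c n).hom) =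
        𝟙_ C ◁ (tpowSucc c n).hom ≫ (λ_ (𝟙_ C)).inv ▷ (tpow c n ⊗ c) ≫
          (symmUnit C n).hom ▷ 𝟙_ C ▷ (tpow c n ⊗ c) := by
      simp only [symmUnit_succ_hom, ← tensorHom_id, ← id_tensorHom, tensorHom_comp_tensorHom,
        Category.assoc, Iso.inv_hom_id, Category.comp_id, Category.id_comp]
    have e₂ : (symmUnit C n).hom ▷ tpow c n ▷ (𝟙_ C ⊗ c) ≫
        (symmTensor (𝟙_ C) c n).hom ▷ (𝟙_ C ⊗ c) ≫ (tpowMap (λ_ c).hom n ⊗ₘ (λ_ c).hom) =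
        (λ_ (tpow c n)).hom ⊗ₘ (λ_ c).hom := by
      simp only [← tensorHom_id, tensorHom_comp_tensorHom, Category.id_comp]
      simp only [tensorHom_id, ih]
    rw [tpowMap_succ, symmTensor_succ_hom]
    simp only [Category.assoc, Iso.inv_hom_id_assoc]
    rw [reassoc_of% e₁, reassoc_of% h, reassoc_of% e₂, ← tensor_left_unitality_assoc,
      leftUnitor_naturality_assoc, Iso.hom_inv_id, Category.comp_id]

theorem symmTensor_rightUnitor (c : C) (n : ℕ) :
    tpow c n ◁ (symmUnit C n).hom ≫ (symmTensor c (𝟙_ C) n).hom ≫ tpowMap (ρ_ c).hom n =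
      (ρ_ (tpow c n)).hom := by
  induction n with
  | zero => simp [tpowMap, symmTensor, symmUnit, unitors_equal]
  | succ n ih =>
    have h := tensorμ_natural (𝟙 (tpow c n)) (𝟙 c) (symmUnit C n).hom (𝟙 (𝟙_ C))
    simp only [tensorHom_id, id_tensorHom, id_whiskerRight] at h
    have e₁ : tpow c (n + 1) ◁ (symmUnit C (n + 1)).hom ≫
        ((tpowSucc c n).hom ⊗ₘ (tpowSucc (𝟙_ C) n).hom) =
        (tpowSucc c n).hom ▷ 𝟙_ C ≫ (tpow c n ⊗ c) ◁ (λ_ (𝟙_ C)).inv ≫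
          (tpow c n ⊗ c) ◁ (symmUnit C n).hom ▷ 𝟙_ C := by
      simp only [symmUnit_succ_hom, ← tensorHom_id, ← id_tensorHom, tensorHom_comp_tensorHom,
        Category.assoc, Iso.inv_hom_id, Category.comp_id, Category.id_comp]
    have e₂ : (tpow c n ◁ (symmUnit C n).hom) ▷ (c ⊗ 𝟙_ C) ≫
        (symmTensor c (𝟙_ C) n).hom ▷ (c ⊗ 𝟙_ C) ≫ (tpowMap (ρ_ c).hom n ⊗ₘ (ρ_ c).hom) =
        (ρ_ (tpow c n)).hom ⊗ₘ (ρ_ c).hom := by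
      simp only [← tensorHom_id, tensorHom_comp_tensorHom, Category.id_comp]
      rw [ih]
    rw [tpowMap_succ, symmTensor_succ_hom]
    simp only [Category.assoc, Iso.inv_hom_id_assoc]
    rw [reassoc_of% e₁, reassoc_of% h, reassoc_of% e₂, ← tensor_right_unitality_assoc,
      rightUnitor_naturality_assoc, Iso.hom_inv_id, Category.comp_id]

end PowerMaps

/-! ### Comparison of tensor powers along a strong monoidal functor. -/

section Comparison

open Functor.LaxMonoidal Functor.Monoidal

variable {C : Type u} [Category.{v} C] [MonoidalCategory C]
  {D : Type u₁} [Category.{v₁} D] [MonoidalCategory D] (F : D ⥤ C) [F.Monoidal]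

/-- The comparison isomorphism `(F d)^n ≅ F (d^n)` of a strong monoidal functor. -/
def tpowComparison (d : D) : ∀ n : ℕ, tpow (F.obj d) n ≅ F.obj (tpow d n)
  | 0 => εIso F
  | n + 1 =>
      tpowSucc (F.obj d) n ≪≫ whiskerRightIso (tpowComparison d n) (F.obj d) ≪≫
        μIso F (tpow d n) d ≪≫ F.mapIso (tpowSucc d n).symm

theorem tpowComparison_zero_hom (d : D) : (tpowComparison F d 0).hom = ε F :=
  rfl

theorem tpowComparison_succ_hom (d : D) (n : ℕ) :
    (tpowComparison F d (n + 1)).hom =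
      (tpowSucc (F.obj d) n).hom ≫ (tpowComparison F d n).hom ▷ F.obj d ≫
        μ F (tpow d n) d ≫ F.map (tpowSucc d n).inv :=
  rfl

theorem tpowAdd_zero_hom (c : C) (m : ℕ) : (tpowAdd c m 0).hom = (ρ_ (tpow c m)).hom :=
  rfl

theorem tpowAdd_succ_hom (c : C) (m n : ℕ) :
    (tpowAdd c m (n + 1)).hom =
      tpow c m ◁ (tpowSucc c n).hom ≫ (α_ (tpow c m) (tpow c n) c).inv ≫
        (tpowAdd c m n).hom ▷ c ≫ (tpowSucc c (m + n)).inv :=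
  rfl

/-- Both the comparison and `tpowAdd` peel off factors on the right, so induction on `n` reduces the
claim to right unitality and associativity of `F`. -/
theorem tpowComparison_tpowAdd (d : D) (m n : ℕ) :
    ((tpowComparison F d m).hom ⊗ₘ (tpowComparison F d n).hom) ≫ μ F (tpow d m) (tpow d n) ≫
        F.map (tpowAdd d m n).hom =
      (tpowAdd (F.obj d) m n).hom ≫ (tpowComparison F d (m + n)).hom := by
  induction n with
  | zero =>
    rw [tpowAdd_zero_hom, tpowAdd_zero_hom, tpowComparison_zero_hom,
      MonoidalCategory.tensorHom_def]
    have := right_unitality F (tpow d m)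
    rw [Category.assoc, ← this]
    exact rightUnitor_naturality (tpowComparison F d m).hom
  | succ n ih =>
    have h := congrArg (· ▷ F.obj d) ih
    simp only [comp_whiskerRight] at h
    have e : (tpowComparison F d (m + (n + 1))).hom = (tpowComparison F d (m + n + 1)).hom := rfl
    rw [tpowAdd_succ_hom, tpowAdd_succ_hom, tpowComparison_succ_hom, e, tpowComparison_succ_hom]
    simp only [Category.assoc, Iso.inv_hom_id_assoc]
    rw [← reassoc_of% h]
    simp only [Functor.map_comp, μ_natural_left_assoc]
    have e₁ : ((tpowComparison F d m).hom ⊗ₘ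
        ((tpowSucc (F.obj d) n).hom ≫ (tpowComparison F d n).hom ▷ F.obj d ≫ μ F (tpow d n) d ≫
          F.map (tpowSucc d n).inv)) =
        tpow (F.obj d) m ◁ (tpowSucc (F.obj d) n).hom ≫
          ((tpowComparison F d m).hom ⊗ₘ ((tpowComparison F d n).hom ⊗ₘ 𝟙 (F.obj d))) ≫
            F.obj (tpow d m) ◁ μ F (tpow d n) d ≫
              F.obj (tpow d m) ◁ F.map (tpowSucc d n).inv := by
      simp only [← id_tensorHom, ← tensorHom_id, tensorHom_comp_tensorHom, Category.comp_id,
        Category.id_comp]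
    rw [e₁, ← tensorHom_id (_ ⊗ₘ _), ← associator_inv_naturality_assoc]
    simp only [Category.assoc, μ_natural_right_assoc]
    rw [← F.map_comp_assoc, ← MonoidalCategory.whiskerLeft_comp, Iso.inv_hom_id,
      MonoidalCategory.whiskerLeft_id, F.map_id, Category.id_comp, associativity_inv_assoc]

theorem tpowComparison_symmUnit (n : ℕ) :
    ε F ≫ F.map (symmUnit D n).hom =
      (symmUnit C n).hom ≫ tpowMap (ε F) n ≫ (tpowComparison F (𝟙_ D) n).hom := by
  induction n with
  | zero => simp [symmUnit, tpowMap, tpowComparison_zero_hom]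
  | succ n ih =>
    rw [symmUnit_succ_hom, symmUnit_succ_hom, tpowMap_succ, tpowComparison_succ_hom]
    simp only [Category.assoc, Iso.inv_hom_id_assoc, Functor.map_comp]
    have e₁ : (symmUnit C n).hom ▷ 𝟙_ C ≫ (tpowMap (ε F) n ⊗ₘ ε F) ≫
        (tpowComparison F (𝟙_ D) n).hom ▷ F.obj (𝟙_ D) =
        𝟙_ C ◁ ε F ≫ ε F ▷ F.obj (𝟙_ D) ≫ F.map (symmUnit D n).hom ▷ F.obj (𝟙_ D) := by
      simp only [← id_tensorHom, ← tensorHom_id, tensorHom_comp_tensorHom, Category.comp_id,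
        Category.id_comp, ih]
    rw [reassoc_of% e₁, μ_natural_left_assoc, ← leftUnitor_inv_naturality_assoc,
      ← left_unitality_inv_assoc]

end Comparison

/-! ### Comparison of the interleaving symmetries along a symmetric functor. -/

section Braided

open Functor.LaxMonoidal Functor.Monoidal

variable {C : Type u} [Category.{v} C] [MonoidalCategory C] [SymmetricCategory C]
  {D : Type u₁} [Category.{v₁} D] [MonoidalCategory D] [SymmetricCategory D]
  (F : D ⥤ C) [F.Braided]

theorem map_tensorμ (a b c d : D) :
    (μ F a b ⊗ₘ μ F c d) ≫ μ F (a ⊗ b) (c ⊗ d) ≫ F.map (tensorμ a b c d) =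
      tensorμ (F.obj a) (F.obj b) (F.obj c) (F.obj d) ≫ (μ F a c ⊗ₘ μ F b d) ≫
        μ F (a ⊗ c) (b ⊗ d) := by
  -- The part of the interchange that swaps the two middle factors; only here is the braiding axiom
  -- of `F` used.
  have inner : F.obj b ◁ μ F c d ≫ μ F b (c ⊗ d) ≫ F.map (α_ b c d).inv ≫
      F.map ((β_ b c).hom ▷ d) ≫ F.map (α_ c b d).hom =
      (α_ (F.obj b) (F.obj c) (F.obj d)).inv ≫ (β_ (F.obj b) (F.obj c)).hom ▷ F.obj d ≫
        (α_ (F.obj c) (F.obj b) (F.obj d)).hom ≫ F.obj c ◁ μ F b d ≫ μ F c (b ⊗ d) := by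
    rw [associativity_inv_assoc, ← μ_natural_left_assoc, ← comp_whiskerRight_assoc,
      Functor.LaxBraided.braided, comp_whiskerRight_assoc, associativity]
  rw [MonoidalCategory.tensorHom_def', MonoidalCategory.tensorHom_def', tensorμ, tensorμ]
  simp only [Functor.map_comp, Category.assoc]
  rw [associativity_assoc, ← μ_natural_right_assoc, ← μ_natural_right_assoc,
    ← μ_natural_right_assoc, associator_naturality_right_assoc]
  simp only [← MonoidalCategory.whiskerLeft_comp_assoc]
  rw [inner]
  simp only [MonoidalCategory.whiskerLeft_comp, Category.assoc]
  rw [associativity_inv, associator_inv_naturality_right_assoc]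

/-- The factor `tpowMap (μ F c d) n` is the discrepancy between `(F c ⊗ F d)^n` and `(F (c ⊗ d))^n`;
it forces the requirement that `μ F c d` be homomorphic. -/
theorem tpowComparison_symmTensor (c d : D) (n : ℕ) :
    ((tpowComparison F c n).hom ⊗ₘ (tpowComparison F d n).hom) ≫ μ F (tpow c n) (tpow d n) ≫
        F.map (symmTensor c d n).hom =
      (symmTensor (F.obj c) (F.obj d) n).hom ≫ tpowMap (μ F c d) n ≫
        (tpowComparison F (c ⊗ d) n).hom := by
  induction n with
  | zero =>
    have := left_unitality F (𝟙_ D)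
    change (ε F ⊗ₘ ε F) ≫ μ F (𝟙_ D) (𝟙_ D) ≫ F.map (λ_ (𝟙_ D)).hom =
      (λ_ (𝟙_ C)).hom ≫ 𝟙 _ ≫ ε F
    rw [tensorHom_def', Category.assoc, ← this, Category.id_comp, leftUnitor_naturality]
  | succ n ih =>
    have e₁ : ((tpowComparison F c (n + 1)).hom ⊗ₘ (tpowComparison F d (n + 1)).hom) =
        ((tpowSucc (F.obj c) n).hom ⊗ₘ (tpowSucc (F.obj d) n).hom) ≫
          (((tpowComparison F c n).hom ⊗ₘ 𝟙 (F.obj c)) ⊗ₘ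
            ((tpowComparison F d n).hom ⊗ₘ 𝟙 (F.obj d))) ≫
          (μ F (tpow c n) c ⊗ₘ μ F (tpow d n) d) ≫
          (F.map (tpowSucc c n).inv ⊗ₘ F.map (tpowSucc d n).inv) := by
      simp only [tpowComparison_succ_hom, tensorHom_comp_tensorHom, tensorHom_id]
    have e₂ : ((tpowComparison F c n).hom ⊗ₘ (tpowComparison F d n).hom) ▷ (F.obj c ⊗ F.obj d) ≫
        (μ F (tpow c n) (tpow d n) ⊗ₘ μ F c d) ≫
          F.map (symmTensor c d n).hom ▷ F.obj (c ⊗ d) =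
        (symmTensor (F.obj c) (F.obj d) n).hom ▷ (F.obj c ⊗ F.obj d) ≫
          (tpowMap (μ F c d) n ⊗ₘ μ F c d) ≫
            (tpowComparison F (c ⊗ d) n).hom ▷ F.obj (c ⊗ d) := by
      simp only [← tensorHom_id, tensorHom_comp_tensorHom, Category.comp_id, Category.id_comp, ih]
    rw [e₁, symmTensor_succ_hom, symmTensor_succ_hom, tpowMap_succ, tpowComparison_succ_hom]
    simp only [Category.assoc, Iso.inv_hom_id_assoc, Functor.map_comp, μ_natural_assoc]
    rw [← F.map_comp_assoc, tensorHom_comp_tensorHom, Iso.inv_hom_id, Iso.inv_hom_id,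
      id_tensorHom_id, F.map_id, Category.id_comp]
    rw [reassoc_of% (map_tensorμ F (tpow c n) c (tpow d n) d), tensorμ_natural_assoc,
      id_tensorHom_id, tensorHom_id, ← μ_natural_left_assoc, reassoc_of% e₂]

end Braided

theorem eqToHom_tensorHom_eqToHom {C : Type u} [Category.{v} C] [MonoidalCategory C]
    {a b c d : C} (h : a = b) (k : c = d) :
    (eqToHom h ⊗ₘ eqToHom k) = eqToHom (congrArg₂ (· ⊗ ·) h k) := by
  subst h k
  simp

/-! ### The supplied morphisms on tensor powers, and homomorphic morphisms. -/

namespace Supply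

open PropCat

variable {P : Type u₁} [Category.{v₁} P] [MonoidalCategory P] [SymmetricCategory P] [PropCat P]
  {C : Type u} [Category.{v} C] [MonoidalCategory C] [SymmetricCategory C] (s : Supply P C)

theorem app_id (c : C) (m : ℕ) : s.app c (𝟙 (ob m : P)) = 𝟙 (tpow c m) := by
  simp [app]

theorem app_comp (c : C) {l m n : ℕ} (f : (ob l : P) ⟶ ob m) (g : (ob m : P) ⟶ ob n) :
    s.app c (f ≫ g) = s.app c f ≫ s.app c g := by
  simp [app]

/-- Naturality of the structure isomorphism of `s_c`, which axiom (ii) identifies with `tpowAdd`. -/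
theorem app_tensorHom (c : C) {m n m' n' : ℕ} (f : (ob m : P) ⟶ ob n) (g : (ob m' : P) ⟶ ob n') :
    (tpowAdd c m m').hom ≫
        s.app c (eqToHom (ob_add m m') ≫ (f ⊗ₘ g) ≫ eqToHom (ob_add n n').symm) =
      (s.app c f ⊗ₘ s.app c g) ≫ (tpowAdd c n n').hom := by
  rw [← s.mu_eq, ← s.mu_eq]
  simp only [app, Functor.map_comp, eqToHom_map, Category.assoc, eqToHom_trans_assoc,
    eqToHom_refl, Category.id_comp, eqToHom_trans]
  rw [← Functor.LaxMonoidal.μ_natural_assoc, tensorHom_comp_tensorHom_assoc,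
    tensorHom_comp_tensorHom_assoc]
  simp

theorem app_braiding (c : C) (m n : ℕ) :
    (tpowAdd c m n).hom ≫
        s.app c (eqToHom (ob_add m n) ≫ (β_ (ob m : P) (ob n)).hom ≫
          eqToHom (ob_add n m).symm) =
      (β_ (tpow c m) (tpow c n)).hom ≫ (tpowAdd c n m).hom := by
  rw [← s.mu_eq, ← s.mu_eq]
  simp only [app, Functor.map_comp, eqToHom_map, Category.assoc, eqToHom_trans_assoc,
    eqToHom_refl, Category.id_comp, eqToHom_trans]
  rw [← BraidedCategory.braiding_naturality_assoc, Functor.LaxBraided.braided_assoc]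

theorem app_symmTensor (c d : C) {m n : ℕ} (f : (ob m : P) ⟶ ob n) :
    (s.app c f ⊗ₘ s.app d f) ≫ (symmTensor c d n).hom =
      (symmTensor c d m).hom ≫ s.app (c ⊗ d) f :=
  s.tensor_comm c d m n f

theorem app_symmUnit {m n : ℕ} (f : (ob m : P) ⟶ ob n) :
    (symmUnit C m).hom ≫ s.app (𝟙_ C) f = (symmUnit C n).hom :=
  (s.unit_comm m n f).symm

/-- A morphism of `C` is homomorphic for a supply if its tensor powers commute with all the supplied
morphisms. -/
def IsHomomorphism {c d : C} (e : c ⟶ d) : Prop :=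
  ∀ ⦃m n : ℕ⦄ (f : (ob m : P) ⟶ ob n), tpowMap e m ≫ s.app d f = s.app c f ≫ tpowMap e n

namespace IsHomomorphism

variable {s}

theorem id (c : C) : s.IsHomomorphism (𝟙 c) := fun m n f => by
  simp [tpowMap_id]

theorem comp {c d e : C} {g : c ⟶ d} {h : d ⟶ e} (hg : s.IsHomomorphism g)
    (hh : s.IsHomomorphism h) : s.IsHomomorphism (g ≫ h) := fun m n f => by
  rw [tpowMap_comp, tpowMap_comp, Category.assoc, hh, reassoc_of% (hg f)]

theorem inv {c d : C} {e : c ≅ d} (he : s.IsHomomorphism e.hom) : s.IsHomomorphism e.inv :=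
  fun m n f => by
    have h := tpowMap e.inv m ≫= (he f =≫ tpowMap e.inv n)
    simp only [Category.assoc, tpowMap_hom_inv, Category.comp_id] at h
    rw [← h, ← Category.assoc, tpowMap_inv_hom, Category.id_comp]

theorem tensorHom {c c' d d' : C} {g : c ⟶ c'} {h : d ⟶ d'} (hg : s.IsHomomorphism g)
    (hh : s.IsHomomorphism h) : s.IsHomomorphism (g ⊗ₘ h) := fun m n f => by
  rw [← cancel_epi (symmTensor c d m).hom, ← reassoc_of% (symmTensor_natural g h m),
    ← app_symmTensor, ← reassoc_of% (app_symmTensor s c d f), ← symmTensor_natural,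
    tensorHom_comp_tensorHom_assoc, tensorHom_comp_tensorHom_assoc, hg, hh]

theorem whiskerRight {c c' : C} {g : c ⟶ c'} (hg : s.IsHomomorphism g) (d : C) :
    s.IsHomomorphism (g ▷ d) := by
  rw [← tensorHom_id]
  exact hg.tensorHom (id d)

/-- By axiom (iii), the morphism supplied at an iterated tensor product is, up to `σ`, the tensor
product of those supplied at `a`, `b` and `c`. Precomposing with the invertible `σ` turns the claim
into naturality of the associator. -/
theorem associator (a b c : C) : s.IsHomomorphism (α_ a b c).hom := fun m n f => by
  have key := symmTensor_associator a b c
  rw [← cancel_epi (symmTensor (a ⊗ b) c m).hom,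
    ← cancel_epi ((symmTensor a b m).hom ▷ tpow c m), reassoc_of% (key m),
    ← app_symmTensor, ← reassoc_of% (app_symmTensor s (a ⊗ b) c f)]
  have e₁ : tpow a m ◁ (symmTensor b c m).hom ≫ (s.app a f ⊗ₘ s.app (b ⊗ c) f) =
      (s.app a f ⊗ₘ (s.app b f ⊗ₘ s.app c f)) ≫ tpow a n ◁ (symmTensor b c n).hom := by
    simp only [← id_tensorHom, tensorHom_comp_tensorHom, app_symmTensor, Category.comp_id,
      Category.id_comp]
  have e₂ : (symmTensor a b m).hom ▷ tpow c m ≫ (s.app (a ⊗ b) f ⊗ₘ s.app c f) =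
      ((s.app a f ⊗ₘ s.app b f) ⊗ₘ s.app c f) ≫ (symmTensor a b n).hom ▷ tpow c n := by
    simp only [← tensorHom_id, tensorHom_comp_tensorHom, app_symmTensor, Category.comp_id,
      Category.id_comp]
  rw [reassoc_of% e₁, reassoc_of% e₂, key n, associator_naturality_assoc]

theorem leftUnitor (c : C) : s.IsHomomorphism (λ_ c).hom := fun m n f => by
  have key := symmTensor_leftUnitor c
  have e : (symmUnit C m).hom ▷ tpow c m ≫ (s.app (𝟙_ C) f ⊗ₘ s.app c f) =
      𝟙_ C ◁ s.app c f ≫ (symmUnit C n).hom ▷ tpow c n := by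
    simp only [← tensorHom_id, ← id_tensorHom, tensorHom_comp_tensorHom, app_symmUnit,
      Category.comp_id, Category.id_comp]
  rw [← cancel_epi (symmTensor (𝟙_ C) c m).hom,
    ← cancel_epi ((symmUnit C m).hom ▷ tpow c m), reassoc_of% (key m),
    ← reassoc_of% (app_symmTensor s (𝟙_ C) c f), reassoc_of% e, key n, leftUnitor_naturality]

theorem rightUnitor (c : C) : s.IsHomomorphism (ρ_ c).hom := fun m n f => by
  have key := symmTensor_rightUnitor c
  have e : tpow c m ◁ (symmUnit C m).hom ≫ (s.app c f ⊗ₘ s.app (𝟙_ C) f) =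
      s.app c f ▷ 𝟙_ C ≫ tpow c n ◁ (symmUnit C n).hom := by
    simp only [← tensorHom_id, ← id_tensorHom, tensorHom_comp_tensorHom, app_symmUnit,
      Category.comp_id, Category.id_comp]
  rw [← cancel_epi (symmTensor c (𝟙_ C) m).hom,
    ← cancel_epi (tpow c m ◁ (symmUnit C m).hom), reassoc_of% (key m),
    ← reassoc_of% (app_symmTensor s c (𝟙_ C) f), reassoc_of% e, key n, rightUnitor_naturality]

theorem tensorFromIso {X Y : C} {e : X ≅ Y} (he : s.IsHomomorphism e.hom) (l : List C) :
    s.IsHomomorphism (tensorFromIso e l).hom := by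
  induction l generalizing X Y with
  | nil => exact he
  | cons c l ih => exact ih (e := whiskerRightIso e c) (he.whiskerRight c)

theorem tensorFromAssoc (X Y : C) (l : List C) :
    s.IsHomomorphism (tensorFromAssoc X Y l).hom := by
  induction l generalizing Y with
  | nil => exact id _
  | cons c l ih =>
    exact (ih (Y ⊗ c)).comp (tensorFromIso (e := (α_ X Y c).symm) (associator X Y c).inv l)

theorem tensorFromAppend (M : List C) (X : C) (l : List C) :
    s.IsHomomorphism (tensorFromAppend M X l).hom := by
  induction l generalizing X with
  | nil =>
    cases M with
    | nil => exact rightUnitor X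
    | cons c M => exact tensorFromAssoc X c M
  | cons c l ih => exact ih (X ⊗ c)

/-- These are the structure isomorphisms of `⨂`, so this is the hypothesis needed to pull the supply
back along `⨂`. -/
theorem bigTensorAppend (L M : List C) : s.IsHomomorphism (bigTensorAppend L M).hom := by
  cases L with
  | nil => exact leftUnitor _
  | cons c l => exact tensorFromAppend M c l

end IsHomomorphism

end Supply

theorem braiding_hom_eqToHom_conj {C : Type u} [Category.{v} C] [MonoidalCategory C]
    [BraidedCategory C] {X X' Y Y' : C} (hX : X' = X) (hY : Y' = Y) :
    (β_ X Y).hom = eqToHom (congrArg₂ (· ⊗ ·) hX hY).symm ≫ (β_ X' Y').hom ≫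
      eqToHom (congrArg₂ (· ⊗ ·) hY hX) := by
  subst hX hY
  simp

/-! ### Tensor powers in a strict monoidal category. -/

section StrictPowers

variable {D : Type u} [Category.{v} D] [MonoidalCategory D] [StrictMonoidal D]

theorem tpow_succ_eq (d : D) (n : ℕ) : tpow d (n + 1) = tpow d n ⊗ d := by
  cases n with
  | zero => exact (StrictMonoidal.unit_tensor d).symm
  | succ n => rfl

theorem tpow_add_eq (d : D) (m n : ℕ) : tpow d m ⊗ tpow d n = tpow d (m + n) := by
  induction n with
  | zero => exact StrictMonoidal.tensor_unit _
  | succ n ih =>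
    rw [tpow_succ_eq d n, ← StrictMonoidal.assoc, ih]
    exact (tpow_succ_eq d (m + n)).symm

theorem leftUnitor_inv_eq (X : D) :
    (λ_ X).inv = eqToHom (StrictMonoidal.unit_tensor X).symm := by
  rw [← cancel_epi (λ_ X).hom, Iso.hom_inv_id, StrictMonoidal.leftUnitor_eq]
  simp

theorem tpowSucc_hom_eq (d : D) (n : ℕ) :
    (tpowSucc d n).hom = eqToHom (tpow_succ_eq d n) := by
  cases n with
  | zero => exact leftUnitor_inv_eq d
  | succ n => rfl

theorem tpowSucc_inv_eq (d : D) (n : ℕ) :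
    (tpowSucc d n).inv = eqToHom (tpow_succ_eq d n).symm := by
  rw [← cancel_epi (tpowSucc d n).hom, Iso.hom_inv_id, tpowSucc_hom_eq]
  simp

theorem associator_inv_eq (X Y Z : D) :
    (α_ X Y Z).inv = eqToHom (StrictMonoidal.assoc X Y Z).symm := by
  rw [← cancel_epi (α_ X Y Z).hom, Iso.hom_inv_id, StrictMonoidal.associator_eq]
  simp

theorem tpowAdd_hom_eq (d : D) (m n : ℕ) :
    (tpowAdd d m n).hom = eqToHom (tpow_add_eq d m n) := by
  induction n with
  | zero => exact StrictMonoidal.rightUnitor_eq _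
  | succ n ih =>
    rw [tpowAdd_succ_hom, ih, tpowSucc_hom_eq, tpowSucc_inv_eq, associator_inv_eq]
    simp only [whiskerLeft_eqToHom, eqToHom_whiskerRight, eqToHom_trans]

end StrictPowers

/-! ### Objects of a prop as natural numbers. -/

namespace PropCat

variable {P : Type u₁} [Category.{v₁} P] [MonoidalCategory P] [SymmetricCategory P] [PropCat P]

/-- The natural number naming an object of a prop. -/
def index (X : P) : ℕ :=
  (ob_bijective.surjective X).choose

theorem ob_index (X : P) : ob (index X) = X :=
  (ob_bijective.surjective X).choose_spec

theorem index_ob (m : ℕ) : index (ob m : P) = m :=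
  (ob_bijective (P := P)).injective (ob_index _)

theorem index_unit : index (𝟙_ P) = 0 := by
  rw [← ob_zero, index_ob]

theorem index_tensor (X Y : P) : index (X ⊗ Y) = index X + index Y := by
  apply (ob_bijective (P := P)).injective
  rw [ob_add, ob_index, ob_index, ob_index]

end PropCat

/-! ### From actions on tensor powers to strict symmetric monoidal functors. -/

open PropCat

/-- An algebra of a prop on the tensor powers of a single object `d`, described by its action on the
morphisms of the prop. -/
structure PowerAlgebra (P : Type u₁) [Category.{v₁} P] [MonoidalCategory P] [SymmetricCategory P]
    [PropCat P] {D : Type u} [Category.{v} D] [MonoidalCategory D] [SymmetricCategory D]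
    (d : D) where
  app : ∀ {m n : ℕ}, ((ob m : P) ⟶ ob n) → (tpow d m ⟶ tpow d n)
  app_id : ∀ m : ℕ, app (𝟙 (ob m : P)) = 𝟙 _
  app_comp : ∀ {l m n : ℕ} (f : (ob l : P) ⟶ ob m) (g : (ob m : P) ⟶ ob n),
    app (f ≫ g) = app f ≫ app g
  app_tensorHom : ∀ {m n m' n' : ℕ} (f : (ob m : P) ⟶ ob n) (g : (ob m' : P) ⟶ ob n'),
    (tpowAdd d m m').hom ≫
        app (eqToHom (ob_add m m') ≫ (f ⊗ₘ g) ≫ eqToHom (ob_add n n').symm) =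
      (app f ⊗ₘ app g) ≫ (tpowAdd d n n').hom
  app_braiding : ∀ m n : ℕ,
    (tpowAdd d m n).hom ≫
        app (eqToHom (ob_add m n) ≫ (β_ (ob m : P) (ob n)).hom ≫ eqToHom (ob_add n m).symm) =
      (β_ (tpow d m) (tpow d n)).hom ≫ (tpowAdd d n m).hom

namespace PowerAlgebra

variable {P : Type u₁} [Category.{v₁} P] [MonoidalCategory P] [SymmetricCategory P] [PropCat P]
  {D : Type u} [Category.{v} D] [MonoidalCategory D] [SymmetricCategory D] {d : D}
  (A : PowerAlgebra P d)

/-- Needed because `index (ob m) = m` and `index (X ⊗ Y) = index X + index Y` hold only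
propositionally. -/
theorem app_conj {m n m' n' : ℕ} (hm : m' = m) (hn : n = n') (f : (ob m : P) ⟶ ob n) :
    A.app (eqToHom (congrArg ob hm) ≫ f ≫ eqToHom (congrArg ob hn)) =
      eqToHom (congrArg (tpow d) hm) ≫ A.app f ≫ eqToHom (congrArg (tpow d) hn) := by
  subst hm hn
  simp

/-- The functor `P ⥤ D` of an algebra of a prop. -/
def functor : P ⥤ D where
  obj X := tpow d (index X)
  map {X Y} f := A.app (eqToHom (ob_index X) ≫ f ≫ eqToHom (ob_index Y).symm)
  map_id X := by simp [A.app_id]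
  map_comp f g := by simp [← A.app_comp]

theorem functor_obj (X : P) : A.functor.obj X = tpow d (index X) :=
  rfl

theorem functor_obj_ob (m : ℕ) : A.functor.obj (ob m) = tpow d m :=
  congrArg (tpow d) (index_ob m)

/-- The outer `eqToHom`s are identities; they separate the types `A.functor.obj X` and `tpow d
(index X)`, so that chains of `eqToHom`s can be merged by rewriting. -/
theorem functor_map {X Y : P} (f : X ⟶ Y) :
    A.functor.map f =
      eqToHom (A.functor_obj X) ≫
        A.app (eqToHom (ob_index X) ≫ f ≫ eqToHom (ob_index Y).symm) ≫
          eqToHom (A.functor_obj Y).symm :=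
  ((Category.id_comp _).trans (Category.comp_id _)).symm

theorem functor_map_ob {m n : ℕ} (f : (ob m : P) ⟶ ob n) :
    eqToHom (A.functor_obj_ob m).symm ≫ A.functor.map f ≫ eqToHom (A.functor_obj_ob n) =
      A.app f := by
  rw [functor_map, A.app_conj (index_ob m) (index_ob n).symm]
  simp

theorem functor_obj_unit : 𝟙_ D = A.functor.obj (𝟙_ P) :=
  congrArg (tpow d) (index_unit (P := P)).symm

variable [StrictMonoidal D]

theorem functor_obj_tensor (X Y : P) :
    A.functor.obj X ⊗ A.functor.obj Y = A.functor.obj (X ⊗ Y) :=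
  (tpow_add_eq d _ _).trans (congrArg (tpow d) (index_tensor X Y).symm)

theorem functor_map_tensorHom {X Y X' Y' : P} (f : X ⟶ Y) (g : X' ⟶ Y') :
    (A.functor.map f ⊗ₘ A.functor.map g) ≫ eqToHom (A.functor_obj_tensor Y Y') =
      eqToHom (A.functor_obj_tensor X X') ≫ A.functor.map (f ⊗ₘ g) := by
  have h := A.app_tensorHom (eqToHom (ob_index X) ≫ f ≫ eqToHom (ob_index Y).symm)
    (eqToHom (ob_index X') ≫ g ≫ eqToHom (ob_index Y').symm)
  rw [tpowAdd_hom_eq, tpowAdd_hom_eq, ← cancel_mono (eqToHom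
    (congrArg (tpow d) (index_tensor Y Y').symm))] at h
  have e : eqToHom (ob_index (X ⊗ X')) ≫ (f ⊗ₘ g) ≫ eqToHom (ob_index (Y ⊗ Y')).symm =
      eqToHom (congrArg ob (index_tensor X X')) ≫
        (eqToHom (ob_add _ _) ≫
          ((eqToHom (ob_index X) ≫ f ≫ eqToHom (ob_index Y).symm) ⊗ₘ
            (eqToHom (ob_index X') ≫ g ≫ eqToHom (ob_index Y').symm)) ≫
              eqToHom (ob_add _ _).symm) ≫
        eqToHom (congrArg ob (index_tensor Y Y').symm) := by
    simp only [← tensorHom_comp_tensorHom, eqToHom_tensorHom_eqToHom, Category.assoc,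
      eqToHom_trans, eqToHom_trans_assoc]
  rw [functor_map A (f ⊗ₘ g), e, A.app_conj (index_tensor X X') (index_tensor Y Y').symm,
    functor_map, functor_map]
  simp only [← tensorHom_comp_tensorHom, eqToHom_tensorHom_eqToHom, Category.assoc,
    eqToHom_trans, eqToHom_trans_assoc] at h ⊢
  rw [← cancel_epi (eqToHom (congrArg₂ (· ⊗ ·) (A.functor_obj X) (A.functor_obj X')))] at h
  simp only [eqToHom_trans_assoc] at h
  rw [← cancel_mono (eqToHom (A.functor_obj (Y ⊗ Y')))]
  simp only [Category.assoc, eqToHom_trans]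
  exact h.symm

theorem functor_map_braiding (X Y : P) :
    eqToHom (A.functor_obj_tensor X Y) ≫ A.functor.map (β_ X Y).hom =
      (β_ (A.functor.obj X) (A.functor.obj Y)).hom ≫ eqToHom (A.functor_obj_tensor Y X) := by
  have h := A.app_braiding (index X) (index Y)
  rw [tpowAdd_hom_eq, tpowAdd_hom_eq, ← cancel_mono (eqToHom
    (congrArg (tpow d) (index_tensor Y X).symm))] at h
  have e : eqToHom (ob_index (X ⊗ Y)) ≫ (β_ X Y).hom ≫ eqToHom (ob_index (Y ⊗ X)).symm =
      eqToHom (congrArg ob (index_tensor X Y)) ≫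
        (eqToHom (ob_add _ _) ≫ (β_ (ob (index X)) (ob (index Y))).hom ≫
          eqToHom (ob_add _ _).symm) ≫
        eqToHom (congrArg ob (index_tensor Y X).symm) := by
    rw [braiding_hom_eqToHom_conj (ob_index X) (ob_index Y)]
    simp only [Category.assoc, eqToHom_trans, eqToHom_trans_assoc]
  rw [functor_map A (β_ X Y).hom, e, A.app_conj (index_tensor X Y) (index_tensor Y X).symm,
    braiding_hom_eqToHom_conj (A.functor_obj X).symm (A.functor_obj Y).symm]
  simp only [Category.assoc, eqToHom_trans, eqToHom_trans_assoc] at h ⊢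
  rw [← cancel_epi (eqToHom (congrArg₂ (· ⊗ ·) (A.functor_obj X) (A.functor_obj Y)))] at h
  simp only [eqToHom_trans_assoc] at h
  rw [← cancel_mono (eqToHom (A.functor_obj (Y ⊗ X)))]
  simp only [Category.assoc, eqToHom_trans]
  exact h

/-- The functor of an algebra in a strict monoidal category is monoidal with identities as structure
isomorphisms. -/
def coreMonoidal : A.functor.CoreMonoidal where
  εIso := eqToIso A.functor_obj_unit
  μIso X Y := eqToIso (A.functor_obj_tensor X Y)
  μIso_hom_natural_left f X' := by
    have h := A.functor_map_tensorHom f (𝟙 X')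
    rwa [A.functor.map_id, tensorHom_id, tensorHom_id] at h
  μIso_hom_natural_right X' f := by
    have h := A.functor_map_tensorHom (𝟙 X') f
    rwa [A.functor.map_id, id_tensorHom, id_tensorHom] at h
  -- By strictness of both `P` and `D`, every morphism in the coherence axioms is an `eqToHom`.
  associativity X Y Z := by
    simp only [eqToIso.hom, StrictMonoidal.associator_eq, eqToHom_map, whiskerLeft_eqToHom,
      eqToHom_whiskerRight, eqToHom_trans]
  left_unitality X := by
    simp only [eqToIso.hom, StrictMonoidal.leftUnitor_eq, eqToHom_map, eqToHom_whiskerRight,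
      eqToHom_trans]
  right_unitality X := by
    simp only [eqToIso.hom, StrictMonoidal.rightUnitor_eq, eqToHom_map, whiskerLeft_eqToHom,
      eqToHom_trans]

instance : A.functor.Monoidal :=
  A.coreMonoidal.toMonoidal

theorem ε_functor : Functor.LaxMonoidal.ε A.functor = eqToHom A.functor_obj_unit :=
  rfl

theorem μ_functor (X Y : P) :
    Functor.LaxMonoidal.μ A.functor X Y = eqToHom (A.functor_obj_tensor X Y) :=
  rfl

instance : A.functor.Braided where
  braided X Y := A.functor_map_braiding X Y

theorem isStrictFunctor : IsStrictFunctor A.functor :=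
  ⟨⟨A.functor_obj_unit, rfl⟩, fun X Y => ⟨A.functor_obj_tensor X Y, rfl⟩⟩

end PowerAlgebra

/-- A supply in a strict monoidal category, from algebras on its objects which are compatible with
tensor products. -/
def Supply.ofAlgebras {P : Type u₁} [Category.{v₁} P] [MonoidalCategory P] [SymmetricCategory P]
    [PropCat P] {D : Type u} [Category.{v} D] [MonoidalCategory D] [SymmetricCategory D]
    [StrictMonoidal D] (A : ∀ d : D, PowerAlgebra P d)
    (tensor_comm : ∀ (c d : D) (m n : ℕ) (f : (ob m : P) ⟶ ob n),
      ((A c).app f ⊗ₘ (A d).app f) ≫ (symmTensor c d n).hom =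
        (symmTensor c d m).hom ≫ (A (c ⊗ d)).app f)
    (unit_comm : ∀ (m n : ℕ) (f : (ob m : P) ⟶ ob n),
      (symmUnit D n).hom = (symmUnit D m).hom ≫ (A (𝟙_ D)).app f) : Supply P D where
  functor d := (A d).functor
  obj_eq d m := (A d).functor_obj_ob m
  mu_eq d m n := by
    rw [PowerAlgebra.μ_functor, tpowAdd_hom_eq]
    simp only [eqToHom_tensorHom_eqToHom, eqToHom_trans]
  tensor_comm c d m n f := by
    simp only [PowerAlgebra.functor_map_ob, tensor_comm]
  unit_comm m n f := by
    rw [PowerAlgebra.functor_map_ob, ← unit_comm]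

open PropCat Functor.LaxMonoidal

/-- Once `Y` is identified with the unit, the hypothesis reads `λ = (e ▷ 𝟙_ C) ≫ ρ = ρ ≫ e`; since
`λ = ρ` at the unit, `e` is the identity. The shape of `he` is left unitality of `s_c` at the unit,
where axiom (ii) makes the structure map a right unitor. -/
theorem eq_eqToHom_of_unitality {C : Type u} [Category.{v} C]
    [MonoidalCategory C] {Y : C} (e : 𝟙_ C ⟶ Y) (h : 𝟙_ C = Y)
    (he : (λ_ Y).hom =
      e ▷ Y ≫ (eqToHom h.symm ⊗ₘ eqToHom h.symm) ≫ (ρ_ (𝟙_ C)).hom ≫ eqToHom h) :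
    e = eqToHom h := by
  subst h
  simp only [eqToHom_refl, id_tensorHom_id, Category.id_comp, Category.comp_id,
    rightUnitor_naturality, unitors_equal] at he
  rw [← cancel_epi (ρ_ (𝟙_ C)).hom, ← he, eqToHom_refl, Category.comp_id]

namespace Supply

/-! ### Pulling a supply back along a fully faithful symmetric monoidal functor. -/

section Pullback

variable {P : Type u₁} [Category.{v₁} P] [MonoidalCategory P] [SymmetricCategory P] [PropCat P]
  {C : Type u} [Category.{v} C] [MonoidalCategory C] [SymmetricCategory C] (s : Supply P C)
  {D : Type u₂} [Category.{v₂} D] [MonoidalCategory D] [SymmetricCategory D]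
  (F : D ⥤ C) [F.Full] [F.Braided]

/-- The morphism `d^m ⟶ d^n` which a fully faithful symmetric monoidal functor `F` sends to the
morphism supplied at `F d`, up to the comparison of tensor powers. -/
def pullbackApp (d : D) {m n : ℕ} (f : (ob m : P) ⟶ ob n) : tpow d m ⟶ tpow d n :=
  F.preimage ((tpowComparison F d m).inv ≫ s.app (F.obj d) f ≫ (tpowComparison F d n).hom)

theorem map_pullbackApp (d : D) {m n : ℕ} (f : (ob m : P) ⟶ ob n) :
    F.map (s.pullbackApp F d f) =
      (tpowComparison F d m).inv ≫ s.app (F.obj d) f ≫ (tpowComparison F d n).hom :=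
  F.map_preimage _

theorem comparison_map_pullbackApp (d : D) {m n : ℕ} (f : (ob m : P) ⟶ ob n) :
    (tpowComparison F d m).hom ≫ F.map (s.pullbackApp F d f) =
      s.app (F.obj d) f ≫ (tpowComparison F d n).hom := by
  rw [map_pullbackApp, Iso.hom_inv_id_assoc]

theorem comparison_map_pullbackApp_tensor (c d : D) {m n m' n' : ℕ} (f : (ob m : P) ⟶ ob n)
    (g : (ob m' : P) ⟶ ob n') :
    ((tpowComparison F c m).hom ⊗ₘ (tpowComparison F d m').hom) ≫ μ F _ _ ≫
        F.map (s.pullbackApp F c f ⊗ₘ s.pullbackApp F d g) =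
      (s.app (F.obj c) f ⊗ₘ s.app (F.obj d) g) ≫
        ((tpowComparison F c n).hom ⊗ₘ (tpowComparison F d n').hom) ≫ μ F _ _ := by
  rw [← μ_natural, tensorHom_comp_tensorHom_assoc, comparison_map_pullbackApp,
    comparison_map_pullbackApp, tensorHom_comp_tensorHom_assoc]

variable [F.Faithful]

/-- The algebra on `d` pulled back from the supply at `F d`. -/
def pullbackAlgebra (d : D) : PowerAlgebra P d where
  app f := s.pullbackApp F d f
  app_id m := F.map_injective (by simp [map_pullbackApp, app_id])
  app_comp f g := F.map_injective (by simp [map_pullbackApp, app_comp])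
  app_tensorHom {m n m' n'} f g := F.map_injective (by
    rw [← cancel_epi (μ F (tpow d m) (tpow d m')),
      ← cancel_epi ((tpowComparison F d m).hom ⊗ₘ (tpowComparison F d m').hom),
      F.map_comp, F.map_comp, reassoc_of% (tpowComparison_tpowAdd F d m m'),
      reassoc_of% (comparison_map_pullbackApp_tensor s F d d f g), comparison_map_pullbackApp,
      tpowComparison_tpowAdd, ← reassoc_of% (app_tensorHom s (F.obj d) f g)])
  app_braiding m n := F.map_injective (by
    rw [← cancel_epi (μ F (tpow d m) (tpow d n)),
      ← cancel_epi ((tpowComparison F d m).hom ⊗ₘ (tpowComparison F d n).hom),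
      F.map_comp, F.map_comp, reassoc_of% (tpowComparison_tpowAdd F d m n),
      comparison_map_pullbackApp, reassoc_of% (app_braiding s (F.obj d) m n),
      Functor.LaxBraided.braided_assoc, BraidedCategory.braiding_naturality_assoc,
      tpowComparison_tpowAdd])

/-- After applying `F` and the comparisons this becomes axiom (iii) for `s`, provided the powers of
`μ F c d` can be moved past the supplied morphisms; `hμ` allows exactly that. -/
theorem pullbackApp_symmTensor (hμ : ∀ c d : D, s.IsHomomorphism (μ F c d)) (c d : D) {m n : ℕ}
    (f : (ob m : P) ⟶ ob n) :
    (s.pullbackApp F c f ⊗ₘ s.pullbackApp F d f) ≫ (symmTensor c d n).hom =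
      (symmTensor c d m).hom ≫ s.pullbackApp F (c ⊗ d) f := by
  apply F.map_injective
  rw [← cancel_epi (μ F (tpow c m) (tpow d m)),
    ← cancel_epi ((tpowComparison F c m).hom ⊗ₘ (tpowComparison F d m).hom),
    F.map_comp, F.map_comp, reassoc_of% (comparison_map_pullbackApp_tensor s F c d f f),
    tpowComparison_symmTensor, reassoc_of% (tpowComparison_symmTensor F c d m),
    comparison_map_pullbackApp, reassoc_of% (hμ c d f), reassoc_of% (app_symmTensor s _ _ f)]

theorem pullbackApp_symmUnit (hε : s.IsHomomorphism (ε F)) {m n : ℕ} (f : (ob m : P) ⟶ ob n) :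
    (symmUnit D n).hom = (symmUnit D m).hom ≫ s.pullbackApp F (𝟙_ D) f := by
  apply F.map_injective
  rw [← cancel_epi (ε F), F.map_comp, reassoc_of% (tpowComparison_symmUnit F m),
    tpowComparison_symmUnit, comparison_map_pullbackApp, reassoc_of% (hε f),
    reassoc_of% (app_symmUnit s f)]

variable [StrictMonoidal D]

/-- The supply pulled back along a fully faithful symmetric monoidal functor from a strict monoidal
category, whose structure morphisms are homomorphic. -/
def pullback (hε : s.IsHomomorphism (ε F)) (hμ : ∀ c d : D, s.IsHomomorphism (μ F c d)) :
    Supply P D :=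
  ofAlgebras (s.pullbackAlgebra F) (fun c d _ _ f => s.pullbackApp_symmTensor F hμ c d f)
    (fun _ _ f => s.pullbackApp_symmUnit F hε f)

end Pullback

/-! ### The structure isomorphisms of a supplied functor are determined. -/

section StructureMorphisms

variable {P : Type u₁} [Category.{v₁} P] [MonoidalCategory P] [SymmetricCategory P] [PropCat P]
  {C : Type u} [Category.{v} C] [MonoidalCategory C] [SymmetricCategory C] (s : Supply P C)

theorem functor_obj (c : C) (X : P) : (s.functor c).obj X = tpow c (index X) := by
  rw [← s.obj_eq, ob_index]

theorem μ_functor (c : C) {X Y : P} {m n : ℕ} (hX : (s.functor c).obj X = tpow c m)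
    (hY : (s.functor c).obj Y = tpow c n) (hXY : (s.functor c).obj (X ⊗ Y) = tpow c (m + n))
    (eX : ob m = X) (eY : ob n = Y) :
    μ (s.functor c) X Y =
      (eqToHom hX ⊗ₘ eqToHom hY) ≫ (tpowAdd c m n).hom ≫ eqToHom hXY.symm := by
  subst eX eY
  rw [← s.mu_eq]
  simp [tensorHom_comp_tensorHom_assoc]

theorem functor_obj_unit (c : C) : 𝟙_ C = (s.functor c).obj (𝟙_ P) := by
  rw [s.functor_obj, index_unit]

/-- Axiom (ii) does not mention the unit isomorphism; left unitality together with (ii) for `m = n =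
0` forces it to be an identity. -/
theorem ε_functor (c : C) : ε (s.functor c) = eqToHom (s.functor_obj_unit c) := by
  apply eq_eqToHom_of_unitality
  have h := left_unitality (s.functor c) (𝟙_ P)
  have h₀ := (s.functor_obj_unit c).symm
  rw [s.μ_functor c (m := 0) (n := 0) h₀ h₀
    ((congrArg (s.functor c).obj (StrictMonoidal.unit_tensor (𝟙_ P))).trans h₀) ob_zero ob_zero,
    StrictMonoidal.leftUnitor_eq (𝟙_ P), eqToHom_map] at h
  simp only [Category.assoc, eqToHom_trans] at h
  exact h

end StructureMorphisms

/-! ### The formula for the functor at a list. -/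

section Blocks

variable {P : Type u₁} [Category.{v₁} P] [MonoidalCategory P] [SymmetricCategory P] [PropCat P]
  {C : Type u} [Category.{v} C] [MonoidalCategory C] [SymmetricCategory C]

/-- Induction on the list: `c :: l` is definitionally `[c] ⊗ l`, so axiom (iii) splits off the head,
and the unit axiom settles the empty list. -/
theorem app_eq_blocks (t : Supply P (Strictification C)) (L : List C) {m n : ℕ}
    (f : (ob m : P) ⟶ ob n) :
    t.app (ofList L) f =
      (blocksSymm m L).inv ≫ blocksMap (fun c => t.app (ofList [c]) f) L ≫
        (blocksSymm n L).hom := by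
  rw [Iso.eq_inv_comp]
  induction L with
  | nil => exact (t.app_symmUnit f).trans (Category.id_comp _).symm
  | cons c l ih =>
    change (tpow (ofList [c]) m ◁ (blocksSymm m l).hom ≫
        (symmTensor (ofList [c]) (ofList l) m).hom) ≫ t.app (ofList [c] ⊗ ofList l) f =
      (t.app (ofList [c]) f ⊗ₘ blocksMap (fun c => t.app (ofList [c]) f) l) ≫
        tpow (ofList [c]) n ◁ (blocksSymm n l).hom ≫
          (symmTensor (ofList [c]) (ofList l) n).hom
    rw [Category.assoc, ← app_symmTensor, ← id_tensorHom, ← id_tensorHom,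
      tensorHom_comp_tensorHom_assoc, tensorHom_comp_tensorHom_assoc, ih, Category.comp_id,
      Category.id_comp]

end Blocks

end Supply

/-! ### The comparison of tensor powers is an identity on singleton lists. -/

section Singletons

variable {C : Type u} [Category.{v} C] [MonoidalCategory C]

theorem tensorFrom_append_singleton (X c : C) (l : List C) :
    tensorFrom X (l ++ [c]) = tensorFrom X l ⊗ c := by
  induction l generalizing X with
  | nil => rfl
  | cons d l ih => exact ih (X ⊗ d)

theorem tensorFromAppend_singleton (X c : C) (l : List C) :
    (tensorFromAppend [c] X l).hom = eqToHom (tensorFrom_append_singleton X c l).symm := by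
  induction l generalizing X with
  | nil => rfl
  | cons d l ih => exact ih (X ⊗ d)

/-- Left bracketing makes appending one object tensoring on the right. The empty list is excluded
because there the isomorphism is a left unitor. -/
theorem bigTensorAppend_singleton (c : C) {L : List C} (hL : L ≠ []) :
    ∃ h : bigTensor L ⊗ c = bigTensor (L ++ [c]), (bigTensorAppend L [c]).hom = eqToHom h := by
  cases L with
  | nil => exact absurd rfl hL
  | cons d l =>
    exact ⟨(tensorFrom_append_singleton d c l).symm, tensorFromAppend_singleton d c l⟩

theorem tpow_singleton_ne_nil (c : C) (n : ℕ) :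
    @Ne (List C) (tpow (C := Strictification C) (ofList [c]) (n + 1)) [] := by
  cases n with
  | zero => exact List.cons_ne_nil c []
  | succ n => exact List.append_ne_nil_of_right_ne_nil _ (List.cons_ne_nil c [])

theorem tpowComparison_singleton (c : C) (n : ℕ) :
    ∃ h : tpow c n = (tensorFunctor C).obj (tpow (ofList [c]) n),
      (tpowComparison (tensorFunctor C) (ofList [c]) n).hom = eqToHom h := by
  induction n with
  | zero => exact ⟨rfl, rfl⟩
  | succ n ih =>
    cases n with
    -- The unitor hidden in `tpowSucc` at `0` cancels the one from appending `[c]` to the empty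
    -- list.
    | zero =>
      refine ⟨rfl, ?_⟩
      change (λ_ c).inv ≫ 𝟙 (𝟙_ C) ▷ c ≫ (λ_ c).hom ≫ 𝟙 c = 𝟙 c
      simp
    | succ n =>
      obtain ⟨h, e⟩ := ih
      obtain ⟨h', e'⟩ := bigTensorAppend_singleton c (tpow_singleton_ne_nil c n)
      refine ⟨(congrArg (· ⊗ c) h).trans h', ?_⟩
      change 𝟙 _ ≫ (tpowComparison (tensorFunctor C) (ofList [c]) (n + 1)).hom ▷ c ≫
        (bigTensorAppend (tpow (C := Strictification C) (ofList [c]) (n + 1)) [c]).hom ≫ 𝟙 _ = _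
      rw [e, e', eqToHom_whiskerRight, Category.comp_id, Category.id_comp, eqToHom_trans]

theorem tpowComparison_singleton_inv (c : C) (n : ℕ)
    (h : (tensorFunctor C).obj (tpow (ofList [c]) n) = tpow c n) :
    (tpowComparison (tensorFunctor C) (ofList [c]) n).inv = eqToHom h := by
  obtain ⟨h', e⟩ := tpowComparison_singleton c n
  rw [← cancel_epi (tpowComparison (tensorFunctor C) (ofList [c]) n).hom, Iso.hom_inv_id, e,
    eqToHom_trans, eqToHom_refl]

end Singletons

/-! ### The induced supply and the factorization of `s_c`. -/

section Main

variable {P : Type u₁} [Category.{v₁} P] [MonoidalCategory P] [SymmetricCategory P] [PropCat P]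
  {C : Type u} [Category.{v} C] [MonoidalCategory C] [SymmetricCategory C] (s : Supply P C)

/-- The supply induced on the strictification. -/
def Supply.strictification : Supply P (Strictification C) :=
  s.pullback (tensorFunctor C) (Supply.IsHomomorphism.id (𝟙_ C))
    (fun L M => Supply.IsHomomorphism.bigTensorAppend L M)

theorem Supply.strictification_singleton (c : C) :
    SameMonoidalFunctor
      (s.strictification.functor (ofList [c]) ⋙ tensorFunctor C) (s.functor c) := by
  let A := s.pullbackAlgebra (tensorFunctor C) (ofList [c])
  change SameMonoidalFunctor (A.functor ⋙ tensorFunctor C) (s.functor c)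
  have hκ (n : ℕ) : tpow c n = (tensorFunctor C).obj (tpow (ofList [c]) n) :=
    (tpowComparison_singleton c n).choose
  have κ_hom (n : ℕ) :
      (tpowComparison (tensorFunctor C) (ofList [c]) n).hom = eqToHom (hκ n) :=
    (tpowComparison_singleton c n).choose_spec
  have hobj (X : P) : (A.functor ⋙ tensorFunctor C).obj X = (s.functor c).obj X :=
    (hκ (index X)).symm.trans (s.functor_obj c X).symm
  refine ⟨CategoryTheory.Functor.ext hobj fun X Y f => ?_, ?_, fun X Y => ?_⟩
  · have e : A.app (eqToHom (ob_index X) ≫ f ≫ eqToHom (ob_index Y).symm) =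
        s.pullbackApp (tensorFunctor C) (ofList [c])
          (eqToHom (ob_index X) ≫ f ≫ eqToHom (ob_index Y).symm) := rfl
    rw [Functor.comp_map, A.functor_map, e]
    simp only [Functor.map_comp, map_pullbackApp, κ_hom,
      tpowComparison_singleton_inv c _ (hκ _).symm, eqToHom_map]
    simp only [Supply.app, Functor.map_comp, eqToHom_map, Category.assoc, eqToHom_trans,
      eqToHom_trans_assoc]
    rfl
  -- The heterogeneous equality is turned into an equality up to `eqToHom`s; both unit isomorphisms
  -- are then identities.
  · rw [← conj_eqToHom_iff_heq' _ _ rfl (hobj _).symm, s.ε_functor, Functor.LaxMonoidal.comp_ε,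
      A.ε_functor, eqToHom_map]
    simp only [eqToHom_trans]
    exact Category.id_comp _
  -- With the comparisons equal to identities, this says that the `μ` of `⨂` on powers of `[c]` is
  -- `tpowAdd` in `C`, hence the `μ` of `s_c` by axiom (ii).
  · have h := tpowComparison_tpowAdd (tensorFunctor C) (ofList [c]) (index X) (index Y)
    rw [κ_hom, κ_hom, κ_hom, tpowAdd_hom_eq, eqToHom_map, eqToHom_tensorHom_eqToHom,
      ← cancel_epi (eqToHom (congrArg₂ (· ⊗ ·) (hκ (index X)) (hκ (index Y))).symm),
      ← cancel_mono (eqToHom (congrArg (fun n => (tensorFunctor C).obj (tpow (ofList [c]) n))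
        (index_tensor X Y).symm))] at h
    simp only [Category.assoc, eqToHom_trans, eqToHom_trans_assoc, eqToHom_refl,
      Category.id_comp] at h
    rw [← conj_eqToHom_iff_heq' _ _ (congrArg₂ (· ⊗ ·) (hobj X) (hobj Y)) (hobj _).symm,
      s.μ_functor c (s.functor_obj c X) (s.functor_obj c Y)
        ((s.functor_obj c _).trans (congrArg (tpow c) (index_tensor X Y))) (ob_index X) (ob_index Y),
      Functor.LaxMonoidal.comp_μ, A.μ_functor, eqToHom_map]
    simp only [eqToHom_tensorHom_eqToHom, Category.assoc, eqToHom_trans, eqToHom_trans_assoc]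
    exact h

end Main

end Supplies

end

theorem mainTheorem3 {P : Type*} [Category P] [MonoidalCategory P] [SymmetricCategory P]
    [Supplies.PropCat P] {C : Type*} [Category C] [MonoidalCategory C] [SymmetricCategory C]
    (s : Supplies.Supply P C) :
    ∃ t : Supplies.Supply P (Supplies.Strictification C),
      (∀ L : List C, Supplies.IsStrictFunctor (t.functor (Supplies.ofList L))) ∧
      (∀ c : C, Supplies.SameMonoidalFunctor
        (t.functor (Supplies.ofList [c]) ⋙ Supplies.tensorFunctor C) (s.functor c)) ∧
      (∀ (L : List C) (m n : ℕ) (f : (Supplies.PropCat.ob m : P) ⟶ Supplies.PropCat.ob n),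
        t.app (Supplies.ofList L) f =
          (Supplies.blocksSymm m L).inv ≫
            Supplies.blocksMap (fun c => t.app (Supplies.ofList [c]) f) L ≫
              (Supplies.blocksSymm n L).hom) := by
  refine ⟨s.strictification, fun L => ?_, s.strictification_singleton, fun L m n f => ?_⟩
  · exact (s.pullbackAlgebra (Supplies.tensorFunctor C) (Supplies.ofList L)).isStrictFunctor
  · exact s.strictification.app_eq_blocks L f
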